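/- Proposition. A piston of mass $M$ moves on the line in an ideal gas of atoms of mass $m$, $0<m<M$. The gas to the left (right) of the piston has spatial density $n_->0$ ($n_+>0$) and velocity density $f_-$ ($f_+$), where $f_\pm$ are even probability densities vanishing unless $v_{\min}<|v|<v_{\max}$, with $0<v_{\min}<v_{\max}<\infty$. Put $p_\pm=n_\pm f_\pm$ and fix $\bar V$ with $0<\bar V<\frac{M-m}{3M+m}v_{\min}$. Let $W(t)$ be the time-homogeneous Markov jump process on $[-\bar V,\bar V]$ in which a piston of velocity $u$ is hit by an atom of velocity $v>0$ at rate $(v-u)\,p_-(v)\,dv$ and by an atom of velocity $v<0$ at rate $(u-v)\,p_+(v)\,dv$; at a hit the velocity jumps to $V'=\frac{M-m}{M+m}u+\frac{2m}{M+m}v$, replaced by $2\bar V-V'$ if $V'>\bar V$ and by $-2\bar V-V'$ if $V'<-\bar V$. Assume that a single reflection always returns the velocity to $[-\bar V,\bar V]$, namely $\frac{M-m}{M+m}\bar V+\frac{2m}{M+m}v_{\max}\le 3\bar V$ (true for $M/m$ large). Then $W(t)$ has a unique stationary probability measure $\mu_0$ on $[-\bar V,\bar V]$, and $\mu_0$ is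 absolutely continuous: $d\mu_0=f_0\,dw$ on $(-\bar V,\bar V)$. If moreover the piston is so heavy that $2m\,v_{\max}\le (M-m)\bar V$, then there is $c_0>0$ with $f_0\ge c_0$ on $(-\bar V,\bar V)$. Finally, there are constants $C,\gamma>0$ such that for every initial probability distribution $\nu$ on $[-\bar V,\bar V]$, the distribution $\nu_t$ of $W(t)$ when $W(0)\sim\nu$ satisfies $$\sup_{A}|\nu_t(A)-\mu_0(A)|\le C e^{-\gamma t}\qquad(t\ge 0),$$ the supremum being over all Borel sets $A\subset\mathbb R$. -/

import Mathlib

open MeasureTheory Set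
open scoped ENNReal

noncomputable section

/-- A heavy piston (mass `M`) in a one-dimensional ideal gas of atoms of mass `m`.  The gas on the
left (right) of the piston has spatial density `nL` (`nR`) and velocity density `fL` (`fR`); both
velocity densities are even and vanish unless `vmin < |v| < vmax`.  The speed of the piston is
kept at most `Vbar` by reflection, where `Vbar` is less than `(M - m) / (3 M + m) * vmin`. -/
structure PistonModel where
  m : ℝ
  M : ℝ
  vmin : ℝ
  vmax : ℝ
  Vbar : ℝ
  nL : ℝ
  nR : ℝ
  fL : ℝ → ℝ
  fR : ℝ → ℝ
  m_pos : 0 < m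
  m_lt_M : m < M
  vmin_pos : 0 < vmin
  vmin_lt_vmax : vmin < vmax
  Vbar_pos : 0 < Vbar
  Vbar_lt : Vbar < (M - m) / (3 * M + m) * vmin
  nL_pos : 0 < nL
  nR_pos : 0 < nR
  fL_measurable : Measurable fL
  fR_measurable : Measurable fR
  fL_nonneg : ∀ v, 0 ≤ fL v
  fR_nonneg : ∀ v, 0 ≤ fR v
  fL_even : ∀ v, fL (-v) = fL v
  fR_even : ∀ v, fR (-v) = fR v
  fL_prob : ∫⁻ v, ENNReal.ofReal (fL v) = 1
  fR_prob : ∫⁻ v, ENNReal.ofReal (fR v) = 1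
  fL_cutoff : ∀ v, |v| ≤ vmin ∨ vmax ≤ |v| → fL v = 0
  fR_cutoff : ∀ v, |v| ≤ vmin ∨ vmax ≤ |v| → fR v = 0

namespace PistonModel

variable (G : PistonModel)

/-- The state space `[-Vbar, Vbar]` of the process. -/
def states : Set ℝ := Icc (-G.Vbar) G.Vbar

/-- Velocity of the piston after an elastic collision with an atom of velocity `v`. -/
def collide (u v : ℝ) : ℝ :=
  (G.M - G.m) / (G.M + G.m) * u + 2 * G.m / (G.M + G.m) * v

/-- Reflection at `± Vbar`. -/
def reflect (w : ℝ) : ℝ :=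
  if G.Vbar < w then 2 * G.Vbar - w
  else if w < -G.Vbar then -2 * G.Vbar - w
  else w

/-- Velocity of the piston after a collision followed by the reflection rule. -/
def jump (u v : ℝ) : ℝ := G.reflect (G.collide u v)

/-- Rate, per unit time and per `dv`, of collisions of a piston of velocity `u` with atoms of
velocity `v`: atoms on the left arrive with `v > 0` and relative speed `v - u`, atoms on the right
arrive with `v < 0` and relative speed `u - v`. -/
def rate (u v : ℝ) : ℝ≥0∞ :=
  if 0 < v then ENNReal.ofReal ((v - u) * (G.nL * G.fL v))
  else ENNReal.ofReal ((u - v) * (G.nR * G.fR v))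

/-- Total collision rate of a piston of velocity `u`. -/
def totalRate (u : ℝ) : ℝ := (∫⁻ v, G.rate u v).toReal

/-- `G.transN n t u A` is the probability that the piston, started with velocity `u`, undergoes
exactly `n` collisions during the time `t` and has its velocity in `A` at time `t`.  With no
collision the velocity stays `u`, which has probability `exp (-t * totalRate u)`; otherwise one
conditions on the time `s` of the first collision and on the velocity `v` of the atom hit. -/
def transN : ℕ → ℝ → ℝ → Set ℝ → ℝ≥0∞
  | 0, t, u, A => ENNReal.ofReal (Real.exp (-G.totalRate u * t)) * A.indicator 1 u
  | n + 1, t, u, A =>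
      ∫⁻ s in Ioc 0 t, ENNReal.ofReal (Real.exp (-G.totalRate u * s)) *
        ∫⁻ v, G.rate u v * transN n (t - s) (G.jump u v) A

/-- Transition probability `P (W (s + t) ∈ A | W s = u)` of the jump process `W`. -/
def trans (t u : ℝ) (A : Set ℝ) : ℝ≥0∞ := ∑' n, G.transN n t u A

/-- The distribution at time `t` of `W` when its initial distribution is `ν`. -/
def evolve (ν : Measure ℝ) (t : ℝ) (A : Set ℝ) : ℝ≥0∞ := ∫⁻ u, G.trans t u A ∂ν

/-- `ν` is a probability distribution on the state space `[-Vbar, Vbar]`. -/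
def IsDistribution (ν : Measure ℝ) : Prop := IsProbabilityMeasure ν ∧ ν G.statesᶜ = 0

/-- `μ` is a stationary measure of the process `W`. -/
def IsStationary (μ : Measure ℝ) : Prop :=
  G.IsDistribution μ ∧ ∀ t, 0 ≤ t → ∀ A, MeasurableSet A → G.evolve μ t A = μ A

/-- `W` is a version of the reflected velocity of the piston on the probability space `(Ω, ℙ)`:
a Markov process on `[0, ∞)` with the above transition probabilities, started in
`[-Vbar, Vbar]`, with right-continuous piecewise constant trajectories. -/
structure IsPistonVelocity {Ω : Type*} [MeasurableSpace Ω] (ℙ : Measure Ω) (W : ℝ → Ω → ℝ) :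
    Prop where
  measurable : ∀ t, 0 ≤ t → Measurable (W t)
  start : ∀ᵐ ω ∂ℙ, W 0 ω ∈ G.states
  markov : ∀ s t, 0 ≤ s → 0 ≤ t → ∀ A, MeasurableSet A → ∀ B,
    MeasurableSet[⨆ r ∈ Icc 0 s, MeasurableSpace.comap (W r) inferInstance] B →
      ℙ (B ∩ W (s + t) ⁻¹' A) = ∫⁻ ω in B, G.trans t (W s ω) A ∂ℙ
  step : ∀ᵐ ω ∂ℙ, ∀ t, 0 ≤ t → ∃ δ > 0, (∀ r ∈ Ico t (t + δ), W r ω = W t ω) ∧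
    ∃ c, ∀ r ∈ Ioo (t - δ) t, 0 ≤ r → W r ω = c

end PistonModel

end

/-!
A small change of the piston velocity can be compensated by a small shift of the atom velocities, so
the laws after one collision from two nearby states overlap by a fixed amount. A collision with a
common atom contracts the distance of two piston velocities by the factor `(M - m) / (M + m)`, so
after finitely many collisions any two states become nearby with positive probability. Hence the
transition kernel over a fixed time has a Dobrushin coefficient less than one, which gives the
unique stationary law and the exponential convergence.

Only paths without collision lead into a null set, so its stationary mass would strictly decrease in
time if it were positive. For a heavy piston, collisions with atoms of two fixed opposite velocities
are contractions whose images cover the state space, so every interval is reached from every state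
and the stationary law has full support. It follows that the set of velocities from which one
collision leads to a given velocity has positive stationary mass. This mass is lower semicontinuous
in the given velocity, hence bounded below on the compact state space, and with it the density.
-/

section

open Filter Topology Pointwise

theorem integral_le_integral_add_of_measureReal_le_add {α : Type*} [MeasurableSpace α]
    {μ ν : Measure α} [IsProbabilityMeasure μ] [IsProbabilityMeasure ν] {δ a b : ℝ}
    (h : ∀ A, MeasurableSet A → μ.real A ≤ ν.real A + δ) {f : α → ℝ} (hf : Measurable f)
    (hab : ∀ x, f x ∈ Icc a b) : ∫ x, f x ∂μ ≤ ∫ x, f x ∂ν + δ * (b - a) := by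
  have hle : a ≤ b := by
    obtain ⟨x⟩ := nonempty_of_isProbabilityMeasure μ
    exact (hab x).1.trans (hab x).2
  have hint (ρ : Measure α) [IsProbabilityMeasure ρ] : Integrable f ρ :=
    .of_bound hf.aestronglyMeasurable (max |a| |b|)
      (.of_forall fun x => abs_le_max_abs_abs (hab x).1 (hab x).2)
  have layer (ρ : Measure α) [IsProbabilityMeasure ρ] :
      ∫ x, f x ∂ρ - a = ∫ t in Ioc 0 (b - a), ρ.real {x | t ≤ f x - a} := by
    rw [← Integrable.integral_eq_integral_Ioc_meas_le (f := fun x => f x - a)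
      ((hint ρ).sub (integrable_const a)) (.of_forall fun x => sub_nonneg.2 (hab x).1)
      (.of_forall fun x => sub_le_sub_right (hab x).2 a),
      integral_sub (hint ρ) (integrable_const a), integral_const, probReal_univ, one_smul]
  have hlevel (ρ : Measure α) [IsProbabilityMeasure ρ] :
      IntegrableOn (fun t => ρ.real {x | t ≤ f x - a}) (Ioc 0 (b - a)) := by
    have hanti : Antitone fun t => ρ.real {x | t ≤ f x - a} :=
      fun s t hst => measureReal_mono fun x hx => hst.trans hx
    exact (hanti.antitoneOn _).integrableOn_isCompact isCompact_Icc |>.mono_set Ioc_subset_Icc_self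
  have hmono : ∫ t in Ioc 0 (b - a), μ.real {x | t ≤ f x - a}
      ≤ ∫ t in Ioc 0 (b - a), (ν.real {x | t ≤ f x - a} + δ) :=
    integral_mono (hlevel μ) ((hlevel ν).add (integrable_const δ)) fun t =>
      h _ (measurableSet_le measurable_const (hf.sub_const a))
  rw [integral_add (hlevel ν) (integrable_const δ), ← layer μ, ← layer ν, setIntegral_const,
    Real.volume_real_Ioc_of_le (sub_nonneg.2 hle), smul_eq_mul] at hmono
  linarith

/- Countable additivity of the limit is an interchange of the limit in `n` with the sum, which the
Moore–Osgood theorem allows because the convergence is uniform over sets. -/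
theorem exists_tendstoUniformlyOn_measureReal {α : Type*} [MeasurableSpace α]
    {μ : ℕ → Measure α} [∀ n, IsProbabilityMeasure (μ n)]
    (h : UniformCauchySeqOn (fun n A => (μ n).real A) atTop {A | MeasurableSet A}) :
    ∃ π : Measure α, IsProbabilityMeasure π ∧
      TendstoUniformlyOn (fun n A => (μ n).real A) (fun A => π.real A) atTop
        {A | MeasurableSet A} := by
  choose! L hL using fun A (hA : MeasurableSet A) => cauchySeq_tendsto_of_complete (h.cauchySeq hA)
  have hunif := h.tendstoUniformlyOn_of_tendsto hL
  have hL_nonneg : ∀ A, MeasurableSet A → 0 ≤ L A := fun A hA =>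
    ge_of_tendsto' (hL A hA) fun n => measureReal_nonneg
  have hL_empty : L ∅ = 0 := tendsto_nhds_unique (hL ∅ .empty) (by simp)
  have hL_univ : L univ = 1 := tendsto_nhds_unique (hL univ .univ) (by simp)
  have hL_iUnion (A : ℕ → Set α) (hA : ∀ i, MeasurableSet (A i))
      (hd : Pairwise (Function.onFun Disjoint A)) :
      HasSum (fun i => L (A i)) (L (⋃ i, A i)) := by
    have hsum (n : ℕ) (s : Finset ℕ) :
        (μ n).real (⋃ i ∈ s, A i) = ∑ i ∈ s, (μ n).real (A i) :=
      measureReal_biUnion_finset (fun i _ j _ hij => hd hij) fun i _ => hA i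
    have hfinite (s : Finset ℕ) : L (⋃ i ∈ s, A i) = ∑ i ∈ s, L (A i) :=
      tendsto_nhds_unique (hL _ (.biUnion s.countable_toSet fun i _ => hA i)) <| by
        simpa only [hsum] using tendsto_finsetSum s fun i _ => hL (A i) (hA i)
    have hpartial : TendstoUniformly (fun n (s : Finset ℕ) => ∑ i ∈ s, (μ n).real (A i))
        (fun s => ∑ i ∈ s, L (A i)) atTop := by
      simp only [← hsum, ← hfinite]
      refine tendstoUniformlyOn_univ.1 ((hunif.comp fun s : Finset ℕ => ⋃ i ∈ s, A i).mono ?_)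
      exact fun s _ => MeasurableSet.biUnion s.countable_toSet fun i _ => hA i
    refine hpartial.tendsto_of_eventually_tendsto (.of_forall fun n => ?_) (hL _ (.iUnion hA))
    have hcount := (μ n).toSignedMeasure.hasSum_of_disjoint_iUnion hA hd
    rw [Measure.toSignedMeasure_apply_measurable (.iUnion hA)] at hcount
    simp only [Measure.toSignedMeasure_apply_measurable (hA _)] at hcount
    exact hcount
  refine ⟨Measure.ofMeasurable (fun A _ => ENNReal.ofReal (L A)) (by simp [hL_empty])
    fun A hA hd => ?_, ⟨?_⟩, ?_⟩
  · rw [← (hL_iUnion A hA hd).tsum_eq]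
    exact ENNReal.ofReal_tsum_of_nonneg (fun i => hL_nonneg _ (hA i)) (hL_iUnion A hA hd).summable
  · rw [Measure.ofMeasurable_apply _ .univ, hL_univ, ENNReal.ofReal_one]
  · refine hunif.congr_right fun A hA => ?_
    simp only [measureReal_def]
    rw [Measure.ofMeasurable_apply A hA, ENNReal.toReal_ofReal (hL_nonneg A hA)]

theorem lowerSemicontinuous_measure_vadd {E : Type*} [AddGroup E] [TopologicalSpace E]
    [IsTopologicalAddGroup E] [LocallyCompactSpace E] [MeasurableSpace E] [BorelSpace E]
    {lam μ : Measure E} [lam.IsAddLeftInvariant] [IsFiniteMeasureOnCompacts lam]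
    [lam.InnerRegularCompactLTTop] [SigmaFinite lam] [IsFiniteMeasure μ] (hμ : μ ≪ lam)
    {K : Set E} (hK : IsCompact K) (hK' : IsClosed K) :
    LowerSemicontinuous fun x : E => μ (x +ᵥ K) := by
  intro x₀ y hy
  have hlam : Tendsto (fun x : E => lam ((x₀ +ᵥ K) \ (x +ᵥ K))) (𝓝 x₀) (𝓝 0) := by
    have hshift : Tendsto (fun x : E => -x + x₀) (𝓝 x₀) (𝓝 0) := by
      have : Continuous fun x : E => -x + x₀ := by fun_prop
      simpa using this.tendsto x₀
    refine ((tendsto_measure_vadd_sdiff_isCompact_isClosed (μ := lam) hK hK').comp hshift).congr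
      fun x => ?_
    rw [Function.comp_apply, ← measure_vadd lam x, vadd_set_sdiff, vadd_vadd, add_neg_cancel_left]
  have hsdiff : Tendsto (fun x : E => μ ((x₀ +ᵥ K) \ (x +ᵥ K))) (𝓝 x₀) (𝓝 0) := by
    simpa only [Measure.setLIntegral_rnDeriv hμ] using tendsto_setLIntegral_zero
      (Measure.lintegral_rnDeriv_lt_top μ lam).ne hlam
  have hsub : Tendsto (fun x : E => μ (x₀ +ᵥ K) - μ ((x₀ +ᵥ K) \ (x +ᵥ K))) (𝓝 x₀)
      (𝓝 (μ (x₀ +ᵥ K))) := by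
    simpa using ENNReal.Tendsto.sub (tendsto_const_nhds (x := μ (x₀ +ᵥ K))) hsdiff
      (.inl (measure_ne_top μ _))
  filter_upwards [hsub.eventually_const_lt hy] with x hx
  refine hx.trans_le (tsub_le_iff_right.2 ((measure_mono ?_).trans (measure_union_le _ _)))
  rw [union_sdiff_self]
  exact subset_union_right

theorem eventually_half_measure_le_inter_add_vadd_sdiff {E : Type*} [AddGroup E]
    [TopologicalSpace E] [IsTopologicalAddGroup E] [LocallyCompactSpace E] [MeasurableSpace E]
    [BorelSpace E] {μ : Measure E} [μ.IsAddLeftInvariant] [IsFiniteMeasureOnCompacts μ]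
    [μ.InnerRegularCompactLTTop] {K : Set E} (hK : IsCompact K) (hK' : IsClosed K) :
    ∀ᶠ x in 𝓝 (0 : E), ∀ S, μ K / 2 ≤ μ (K ∩ S) + μ ((x +ᵥ K) \ S) := by
  have hfin : μ K ≠ ∞ := hK.measure_lt_top.ne
  rcases eq_or_ne (μ K) 0 with h0 | h0
  · simp [h0]
  have hshift := tendsto_measure_vadd_sdiff_isCompact_isClosed (μ := μ) hK hK'
  filter_upwards [hshift.eventually_lt_const (ENNReal.half_pos h0)] with x hx S
  have hcover : x +ᵥ K ⊆ K ∩ S ∪ (x +ᵥ K) \ S ∪ (x +ᵥ K) \ K := by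
    intro y hy
    by_cases hyS : y ∈ S <;> by_cases hyK : y ∈ K <;> simp [hy, hyS, hyK]
  have hle : μ K / 2 + μ K / 2 ≤ μ (K ∩ S) + μ ((x +ᵥ K) \ S) + μ K / 2 :=
    calc μ K / 2 + μ K / 2 = μ (x +ᵥ K) := by rw [ENNReal.add_halves, measure_vadd]
      _ ≤ μ (K ∩ S) + μ ((x +ᵥ K) \ S) + μ ((x +ᵥ K) \ K) :=
        (measure_mono hcover).trans <| (measure_union_le _ _).trans <| by
          gcongr
          apply measure_union_le
      _ ≤ μ (K ∩ S) + μ ((x +ᵥ K) \ S) + μ K / 2 := by gcongr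
  exact (ENNReal.add_le_add_iff_right (ENNReal.div_ne_top hfin two_ne_zero)).1 hle

theorem exists_density_ge {α : Type*} [MeasurableSpace α] {μ ν : Measure α} [IsFiniteMeasure μ]
    [IsFiniteMeasure ν] (hμ : μ ≪ ν) {c : ℝ≥0∞} (hc : c ≠ ⊤) (h : c • ν ≤ μ) :
    ∃ f : α → ℝ≥0∞, Measurable f ∧ μ = ν.withDensity f ∧ ∀ x, c ≤ f x := by
  have hfin : IsFiniteMeasure (c • ν) := Measure.smul_finite ν hc
  have hsub : μ - c • ν ≪ ν := (Measure.absolutelyContinuous_of_le Measure.sub_le).trans hμ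
  refine ⟨(μ - c • ν).rnDeriv ν + fun _ => c, (Measure.measurable_rnDeriv _ _).add_const c, ?_,
    fun x => le_add_self⟩
  rw [withDensity_add_left (Measure.measurable_rnDeriv _ _),
    Measure.withDensity_rnDeriv_eq _ _ hsub, withDensity_const, Measure.sub_add_cancel_of_le h]

/- A point of `S` is the image of a point of `S` under a composition of `n` of the maps, and such a
composition brings it within `K ^ n * D` of `F`, for a bound `D` of the distance from `S` to `F`. -/
theorem subset_of_subset_iUnion_image_of_contracting {α ι : Type*} [PseudoMetricSpace α]
    {T : ι → α → α} {K : NNReal} (hK : K < 1) (hT : ∀ i, LipschitzWith K (T i)) {S F : Set α}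
    (hS : Bornology.IsBounded S) (hcover : S ⊆ ⋃ i, T i '' S) (hF : IsClosed F)
    (hne : F.Nonempty) (hinv : ∀ i, MapsTo (T i) F F) : S ⊆ F := by
  obtain ⟨z, hz⟩ := hne
  obtain ⟨D, hD⟩ := hS.subset_closedBall z
  have hclose (n : ℕ) : ∀ y ∈ S, ∃ x ∈ F, dist y x ≤ K ^ n * D := by
    induction n with
    | zero => exact fun y hy => ⟨z, hz, by simpa using hD hy⟩
    | succ n ih =>
      intro y hy
      obtain ⟨i, u, hu, rfl⟩ := mem_iUnion.1 (hcover hy)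
      obtain ⟨x, hx, hdist⟩ := ih u hu
      refine ⟨T i x, hinv i hx, ?_⟩
      calc dist (T i u) (T i x) ≤ K * dist u x := (hT i).dist_le_mul u x
        _ ≤ K * (K ^ n * D) := by gcongr
        _ = K ^ (n + 1) * D := by ring
  have hlim : Tendsto (fun n => (K : ℝ) ^ n * D) atTop (𝓝 0) := by
    simpa using (tendsto_pow_atTop_nhds_zero_of_lt_one K.2 (mod_cast hK)).mul_const D
  intro y hy
  rw [← hF.closure_eq, Metric.mem_closure_iff]
  intro ε hε
  obtain ⟨n, hn⟩ := (hlim.eventually_lt_const hε).exists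
  obtain ⟨x, hx, hdist⟩ := hclose n y hy
  exact ⟨x, hx, hdist.trans_lt hn⟩

theorem exists_isCompact_le_of_setLIntegral_ne_zero {α : Type*} [TopologicalSpace α]
    [MeasurableSpace α] {μ : Measure α} [μ.InnerRegular] {f : α → ℝ≥0∞} (hf : Measurable f)
    {s : Set α} (hs : MeasurableSet s) (h : ∫⁻ x in s, f x ∂μ ≠ 0) :
    ∃ K ⊆ s, IsCompact K ∧ 0 < μ K ∧ ∃ c ≠ 0, ∀ x ∈ K, c ≤ f x := by
  have hcover : s ∩ Function.support f ⊆ ⋃ n : ℕ, s ∩ {x | (n : ℝ≥0∞)⁻¹ < f x} := by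
    rintro x ⟨hx, hfx⟩
    obtain ⟨n, hn⟩ := ENNReal.exists_inv_nat_lt hfx
    exact mem_iUnion.2 ⟨n, hx, hn⟩
  have hpos : μ (⋃ n : ℕ, s ∩ {x | (n : ℝ≥0∞)⁻¹ < f x}) ≠ 0 := by
    refine mt (measure_mono_null hcover) (ne_of_gt ?_)
    rwa [inter_comm, ← setLIntegral_pos_iff hf, pos_iff_ne_zero]
  obtain ⟨n, hn⟩ := exists_measure_pos_of_not_measure_iUnion_null hpos
  obtain ⟨K, hK, hKc, hKμ⟩ :=
    (hs.inter (measurableSet_lt measurable_const hf)).exists_lt_isCompact hn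
  exact ⟨K, fun x hx => (hK hx).1, hKc, hKμ, (n : ℝ≥0∞)⁻¹, by simp, fun x hx => (hK hx).2.le⟩

theorem setLIntegral_Ioc_comp_sub_left (f : ℝ → ℝ≥0∞) (t : ℝ) :
    ∫⁻ s in Ioc 0 t, f (t - s) = ∫⁻ r in Ico 0 t, f r := by
  have h := (Measure.measurePreserving_sub_left volume t).setLIntegral_comp_preimage_emb
    (MeasurableEquiv.subLeft t).measurableEmbedding f (Ico 0 t)
  simpa using h

theorem setLIntegral_Iio_eq_setLIntegral_Ioi_of_even {f : ℝ → ℝ≥0∞} (heven : ∀ x, f (-x) = f x) :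
    ∫⁻ x in Iio 0, f x = ∫⁻ x in Ioi 0, f x := by
  have h := (Measure.measurePreserving_neg (volume : Measure ℝ)).setLIntegral_comp_preimage_emb
    (MeasurableEquiv.neg ℝ).measurableEmbedding f (Ioi 0)
  simpa [heven] using h

theorem setLIntegral_Ioi_ne_zero_of_even {f : ℝ → ℝ≥0∞} (heven : ∀ x, f (-x) = f x)
    (h : ∫⁻ x, f x ≠ 0) : ∫⁻ x in Ioi 0, f x ≠ 0 := by
  intro h0
  rw [← lintegral_add_compl f (measurableSet_Ioi (a := (0 : ℝ))), compl_Ioi,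
    setLIntegral_congr Iio_ae_eq_Iic.symm, setLIntegral_Iio_eq_setLIntegral_Ioi_of_even heven,
    h0, add_zero] at h
  exact h rfl

end

section

open ProbabilityTheory Filter Topology

variable {α : Type*} [MeasurableSpace α]

/-- Dobrushin's contraction coefficient of `κ`, the largest total variation distance between two of
the measures `κ u`, is at most `d`. -/
def DobrushinLE (κ : Kernel α α) (d : ℝ) : Prop :=
  ∀ u u' A, MeasurableSet A → (κ u).real A ≤ (κ u').real A + d

namespace DobrushinLE

variable {κ η : Kernel α α} {a b d : ℝ}

theorem mono (h : DobrushinLE κ a) (hab : a ≤ b) : DobrushinLE κ b := fun u u' A hA =>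
  (h u u' A hA).trans (by gcongr)

theorem one (κ : Kernel α α) [IsMarkovKernel κ] : DobrushinLE κ 1 := fun u u' A _ => by
  linarith [measureReal_le_one (μ := κ u) (s := A), measureReal_nonneg (μ := κ u') (s := A)]

theorem measureReal_comp_le [IsMarkovKernel κ] (h : DobrushinLE κ d) {ν ν' : Measure α}
    [IsProbabilityMeasure ν] [IsProbabilityMeasure ν'] {δ : ℝ}
    (hδ : ∀ A, MeasurableSet A → ν.real A ≤ ν'.real A + δ) {A : Set α} (hA : MeasurableSet A) :
    (κ ∘ₘ ν).real A ≤ (κ ∘ₘ ν').real A + δ * d := by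
  obtain ⟨u₀⟩ := nonempty_of_isProbabilityMeasure ν
  have hmeas : Measurable fun u => (κ u).real A := κ.measurable_coe hA |>.ennreal_toReal
  have hcomp (ρ : Measure α) : (κ ∘ₘ ρ).real A = ∫ u, (κ u).real A ∂ρ := by
    rw [measureReal_def, Measure.bind_apply hA κ.aemeasurable]
    exact (integral_toReal (κ.measurable_coe hA).aemeasurable
      (.of_forall fun u => measure_lt_top _ _)).symm
  have hbdd : BddBelow (range fun u => (κ u).real A) := ⟨0, by rintro _ ⟨u, rfl⟩; positivity⟩
  have hrange (u : α) : (κ u).real A ∈ Icc (⨅ u, (κ u).real A) ((⨅ u, (κ u).real A) + d) := by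
    have : Nonempty α := ⟨u₀⟩
    refine ⟨ciInf_le hbdd u, sub_le_iff_le_add.1 (le_ciInf fun u' => ?_)⟩
    exact sub_le_iff_le_add.2 (h u u' A hA)
  simpa [hcomp] using integral_le_integral_add_of_measureReal_le_add hδ hmeas hrange

theorem comp [IsMarkovKernel κ] [IsMarkovKernel η] (hκ : DobrushinLE κ a) (hη : DobrushinLE η b) :
    DobrushinLE (κ ∘ₖ η) (a * b) := fun u u' A hA => by
  rw [Kernel.comp_apply, Kernel.comp_apply, mul_comm]
  exact hκ.measureReal_comp_le (hη u u') hA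

theorem abs_measureReal_comp_sub_le [IsMarkovKernel κ] (h : DobrushinLE κ d) (ν ν' : Measure α)
    [IsProbabilityMeasure ν] [IsProbabilityMeasure ν'] {A : Set α} (hA : MeasurableSet A) :
    |(κ ∘ₘ ν).real A - (κ ∘ₘ ν').real A| ≤ d := by
  have key (ρ ρ' : Measure α) [IsProbabilityMeasure ρ] [IsProbabilityMeasure ρ'] :
      (κ ∘ₘ ρ).real A ≤ (κ ∘ₘ ρ').real A + d := by
    simpa using h.measureReal_comp_le (ν := ρ) (ν' := ρ') (δ := 1) (fun B _ => by
      linarith [measureReal_le_one (μ := ρ) (s := B), measureReal_nonneg (μ := ρ') (s := B)]) hA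
  exact abs_sub_le_iff.2 ⟨by linarith [key ν ν'], by linarith [key ν' ν]⟩

end DobrushinLE

section Semigroup

variable {P : ℝ → Kernel α α} [∀ t, IsMarkovKernel (P t)]

theorem DobrushinLE.exists_exp_decay {t₀ q : ℝ} (h : DobrushinLE (P t₀) q) (ht₀ : 0 < t₀)
    (hq : q < 1) (hP : ∀ s t, 0 ≤ s → 0 ≤ t → P (s + t) = P t ∘ₖ P s) :
    ∃ C γ : ℝ, 0 < C ∧ 0 < γ ∧ ∀ t, 0 ≤ t → DobrushinLE (P t) (C * Real.exp (-γ * t)) := by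
  obtain ⟨r, hr, hr1⟩ := exists_between (max_lt hq one_pos)
  obtain ⟨hqr, hr0⟩ := max_lt_iff.1 hr
  have hpow (n : ℕ) : DobrushinLE (P (n * t₀)) (r ^ n) := by
    induction n with
    | zero => simpa using DobrushinLE.one _
    | succ n ih =>
      rw [Nat.cast_succ, add_one_mul, add_comm, hP _ _ ht₀.le (by positivity), pow_succ]
      exact ih.comp (h.mono hqr.le)
  have hlog : Real.log r < 0 := Real.log_neg hr0 hr1
  refine ⟨r⁻¹, -Real.log r / t₀, by positivity, div_pos (neg_pos.2 hlog) ht₀, fun t ht => ?_⟩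
  have hle : (⌊t / t₀⌋₊ : ℝ) * t₀ ≤ t := (le_div_iff₀ ht₀).1 (Nat.floor_le (by positivity))
  have hsplit : P t = P (t - ⌊t / t₀⌋₊ * t₀) ∘ₖ P (⌊t / t₀⌋₊ * t₀) := by
    rw [← hP _ _ (by positivity) (sub_nonneg.2 hle), add_sub_cancel]
  rw [hsplit]
  refine ((DobrushinLE.one _).comp (hpow _)).mono ?_
  calc 1 * r ^ ⌊t / t₀⌋₊ = r ^ (⌊t / t₀⌋₊ : ℝ) := by rw [one_mul, Real.rpow_natCast]
    _ ≤ r ^ (t / t₀ - 1) :=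
      Real.rpow_le_rpow_of_exponent_ge hr0 hr1.le (Nat.sub_one_lt_floor _).le
    _ = r⁻¹ * Real.exp (-(-Real.log r / t₀) * t) := by
      rw [Real.rpow_sub_one hr0.ne', Real.rpow_def_of_pos hr0, div_eq_inv_mul]
      congr 2
      ring

theorem tendsto_const_mul_exp_neg_mul (C : ℝ) {γ : ℝ} (hγ : 0 < γ) :
    Tendsto (fun t => C * Real.exp (-γ * t)) atTop (𝓝 0) := by
  simpa using (Real.tendsto_exp_atBot.comp
    (tendsto_id.const_mul_atTop_of_neg (neg_neg_of_pos hγ))).const_mul C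

theorem uniformCauchySeqOn_of_exp_decay {C γ : ℝ} (hγ : 0 < γ)
    (hP : ∀ s t, 0 ≤ s → 0 ≤ t → P (s + t) = P t ∘ₖ P s)
    (hdecay : ∀ t, 0 ≤ t → DobrushinLE (P t) (C * Real.exp (-γ * t))) (u : α) :
    UniformCauchySeqOn (fun (n : ℕ) A => (P n u).real A) atTop {A | MeasurableSet A} := by
  rw [Metric.uniformCauchySeqOn_iff]
  intro ε hε
  obtain ⟨N, hN⟩ := ((tendsto_const_mul_exp_neg_mul C hγ).comp
    tendsto_natCast_atTop_atTop).eventually_lt_const (half_pos hε) |>.exists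
  have hclose {n : ℕ} (hn : N ≤ n) {A : Set α} (hA : MeasurableSet A) :
      dist ((P n u).real A) ((P N u).real A) < ε / 2 := by
    have hsplit : P n u = P N ∘ₘ P (n - N : ℕ) u := by
      rw [← Kernel.comp_apply, ← hP _ _ (Nat.cast_nonneg _) N.cast_nonneg, ← Nat.cast_add,
        Nat.sub_add_cancel hn]
    have h := (hdecay N N.cast_nonneg).abs_measureReal_comp_sub_le (P (n - N : ℕ) u) (.dirac u) hA
    rw [← hsplit, Measure.dirac_bind (P N).measurable] at h
    exact h.trans_lt hN
  exact ⟨N, fun m hm n hn A hA => by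
    linarith [dist_triangle_right ((P m u).real A) ((P n u).real A) ((P N u).real A),
      hclose hm hA, hclose hn hA]⟩

theorem exists_invariant_of_exp_decay [Nonempty α] {C γ : ℝ} (hγ : 0 < γ)
    (hP : ∀ s t, 0 ≤ s → 0 ≤ t → P (s + t) = P t ∘ₖ P s)
    (hdecay : ∀ t, 0 ≤ t → DobrushinLE (P t) (C * Real.exp (-γ * t))) :
    ∃ π : Measure α, IsProbabilityMeasure π ∧ ∀ t, 0 ≤ t → (P t).Invariant π := by
  obtain ⟨u⟩ := ‹Nonempty α›
  obtain ⟨π, hπ, hlim⟩ := exists_tendstoUniformlyOn_measureReal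
    (uniformCauchySeqOn_of_exp_decay hγ hP hdecay u)
  refine ⟨π, hπ, fun t ht => Measure.ext fun A hA => ?_⟩
  have hpush : Tendsto (fun n : ℕ => (P t ∘ₘ P n u).real A) atTop (𝓝 ((P t ∘ₘ π).real A)) := by
    refine Metric.tendsto_atTop.2 fun ε hε => ?_
    obtain ⟨N, hN⟩ :=
      eventually_atTop.1 (Metric.tendstoUniformlyOn_iff.1 hlim (ε / 2) (half_pos hε))
    refine ⟨N, fun n hn => ?_⟩
    have hclose (B : Set α) (hB : MeasurableSet B) := abs_lt.1 (hN n hn B hB)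
    have h₁ := (DobrushinLE.one (P t)).measureReal_comp_le (ν := P n u) (ν' := π)
      (fun B hB => by linarith [hclose B hB]) hA (δ := ε / 2)
    have h₂ := (DobrushinLE.one (P t)).measureReal_comp_le (ν := π) (ν' := P n u)
      (fun B hB => by linarith [hclose B hB]) hA (δ := ε / 2)
    exact abs_lt.2 ⟨by linarith, by linarith⟩
  have hforget : Tendsto (fun n : ℕ => (P t ∘ₘ P n u).real A - (P n u).real A) atTop (𝓝 0) := by
    refine squeeze_zero_norm (fun n => ?_)
      ((tendsto_const_mul_exp_neg_mul C hγ).comp tendsto_natCast_atTop_atTop)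
    have h := (hdecay n n.cast_nonneg).abs_measureReal_comp_sub_le (P t u) (.dirac u) hA
    rw [Measure.dirac_bind (P n).measurable, ← Kernel.comp_apply, ← hP _ _ ht n.cast_nonneg,
      add_comm, hP _ _ n.cast_nonneg ht, Kernel.comp_apply] at h
    exact h
  have heq := tendsto_nhds_unique (hforget.add (hlim.tendsto_at hA)) (by simpa using hpush)
  rw [zero_add] at heq
  exact ((measureReal_eq_measureReal_iff (by finiteness) (by finiteness)).1 heq).symm

theorem DobrushinLE.exists_invariant [Nonempty α] {t₀ q : ℝ} (h : DobrushinLE (P t₀) q)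
    (ht₀ : 0 < t₀) (hq : q < 1) (hP : ∀ s t, 0 ≤ s → 0 ≤ t → P (s + t) = P t ∘ₖ P s) :
    ∃ π : Measure α, IsProbabilityMeasure π ∧ (∀ t, 0 ≤ t → (P t).Invariant π) ∧
      (∀ ν : Measure α, IsProbabilityMeasure ν → (∀ t, 0 ≤ t → (P t).Invariant ν) → ν = π) ∧
      ∃ C γ : ℝ, 0 < C ∧ 0 < γ ∧ ∀ ν : Measure α, IsProbabilityMeasure ν → ∀ t, 0 ≤ t →
        ∀ A, MeasurableSet A → |(P t ∘ₘ ν).real A - π.real A| ≤ C * Real.exp (-γ * t) := by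
  obtain ⟨C, γ, hC, hγ, hdecay⟩ := h.exists_exp_decay ht₀ hq hP
  obtain ⟨π, hπ, hinv⟩ := exists_invariant_of_exp_decay hγ hP hdecay
  have hconv (ν : Measure α) (_ : IsProbabilityMeasure ν) (t : ℝ) (ht : 0 ≤ t) (A : Set α)
      (hA : MeasurableSet A) : |(P t ∘ₘ ν).real A - π.real A| ≤ C * Real.exp (-γ * t) := by
    simpa only [(hinv t ht).def] using (hdecay t ht).abs_measureReal_comp_sub_le ν π hA
  refine ⟨π, hπ, hinv, fun ν hν hν' => Measure.ext fun A hA => ?_, C, γ, hC, hγ, hconv⟩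
  have hzero : |ν.real A - π.real A| ≤ 0 :=
    ge_of_tendsto (tendsto_const_mul_exp_neg_mul C hγ) <|
      (eventually_ge_atTop 0).mono fun t ht => by
        simpa only [(hν' t ht).def] using hconv ν hν t ht A hA
  exact (measureReal_eq_measureReal_iff (by finiteness) (by finiteness)).1
    (sub_eq_zero.1 (abs_nonpos_iff.1 hzero))

end Semigroup

end

section

open ProbabilityTheory Filter Topology

namespace JumpProcess

variable {α : Type*} [MeasurableSpace α] (κ : Kernel α α)

/-- The probability that the process with jump rates `κ` does not leave `u` during the time `t`,
with negative times read as `0`. -/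
noncomputable def survival (u : α) (t : ℝ) : ℝ≥0∞ :=
  ENNReal.ofReal (Real.exp (-(κ u).real univ * max t 0))

/-- The position, restricted to the event of no jump, of the process with jump rates `κ` that starts
at `p.2` and runs for the time `p.1`. -/
noncomputable def stay : Kernel (ℝ × α) α :=
  (Kernel.id.comap Prod.snd measurable_snd).withDensity fun p _ => survival κ p.2 p.1

/-- The remaining time and the position right after the first jump, restricted to the event that
there is one, of the process with jump rates `κ` that starts at `p.2` and runs for the
time `p.1`. -/
noncomputable def hit : Kernel (ℝ × α) (ℝ × α) :=
  (Kernel.const _ volume ×ₖ κ.comap Prod.snd measurable_snd).withDensity fun p x =>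
    (Ico 0 p.1).indicator (fun r => survival κ p.2 (p.1 - r)) x.1

/-- The position after exactly `n` jumps, restricted to the event that these are all the jumps, of
the process with jump rates `κ` that starts at `p.2` and runs for the time `p.1`. -/
noncomputable def jumpLaw (n : ℕ) : Kernel (ℝ × α) α := stay κ ∘ₖ (hit κ ^ n)

/-- The final position of the process with jump rates `κ` that starts at `p.2` and runs for the
time `p.1`; there is no loss of mass by infinitely many jumps since the rates are bounded. -/
noncomputable def law : Kernel (ℝ × α) α := Kernel.sum (jumpLaw κ)

/-- The transition kernel over the time `t` of the process with jump rates `κ`. -/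
noncomputable def semigroup (t : ℝ) : Kernel α α := (law κ).comap (Prod.mk t) measurable_prodMk_left

variable {κ}

theorem survival_of_nonneg (u : α) {t : ℝ} (ht : 0 ≤ t) :
    survival κ u t = ENNReal.ofReal (Real.exp (-(κ u).real univ * t)) := by
  rw [survival, max_eq_left ht]

theorem survival_add (u : α) {s t : ℝ} (hs : 0 ≤ s) (ht : 0 ≤ t) :
    survival κ u (s + t) = survival κ u s * survival κ u t := by
  rw [survival_of_nonneg u hs, survival_of_nonneg u ht, survival_of_nonneg u (add_nonneg hs ht),
    ← ENNReal.ofReal_mul (Real.exp_pos _).le, ← Real.exp_add, mul_add]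

theorem measurable_survival {β : Type*} [MeasurableSpace β] {f : β → α} {g : β → ℝ}
    (hf : Measurable f) (hg : Measurable g) : Measurable fun x => survival κ (f x) (g x) := by
  have hrate : Measurable fun x => (κ (f x)).real univ :=
    ((κ.measurable_coe .univ).comp hf).ennreal_toReal
  exact (hrate.neg.mul (hg.max measurable_const)).exp.ennreal_ofReal

theorem lintegral_stay (t : ℝ) (u : α) {φ : α → ℝ≥0∞} (hφ : Measurable φ) :
    ∫⁻ w, φ w ∂stay κ (t, u) = survival κ u t * φ u := by
  rw [stay, Kernel.lintegral_withDensity _ (measurable_survival (by fun_prop) (by fun_prop)) _ hφ,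
    Kernel.comap_apply, Kernel.id_apply, lintegral_dirac' _ (by fun_prop)]

theorem stay_univ (t : ℝ) (u : α) : stay κ (t, u) univ = survival κ u t := by
  simpa using lintegral_stay (κ := κ) t u (measurable_const (a := 1))

theorem jumpLaw_zero : jumpLaw κ 0 = stay κ := Kernel.comp_id _

theorem jumpLaw_succ (n : ℕ) : jumpLaw κ (n + 1) = jumpLaw κ n ∘ₖ hit κ := by
  rw [jumpLaw, pow_succ]
  exact (Kernel.comp_assoc _ _ _).symm

theorem lintegral_law (p : ℝ × α) {φ : α → ℝ≥0∞} (hφ : Measurable φ) :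
    ∫⁻ w, φ w ∂law κ p = ∫⁻ w, φ w ∂stay κ p + ∫⁻ x, ∫⁻ w, φ w ∂law κ x ∂hit κ p := by
  have hsum (x : ℝ × α) : ∫⁻ w, φ w ∂law κ x = ∑' n, ∫⁻ w, φ w ∂jumpLaw κ n x := by
    rw [law, Kernel.sum_apply, lintegral_sum_measure]
  have hsucc (n : ℕ) :
      ∫⁻ w, φ w ∂jumpLaw κ (n + 1) p = ∫⁻ x, ∫⁻ w, φ w ∂jumpLaw κ n x ∂hit κ p := by
    rw [jumpLaw_succ, Kernel.lintegral_comp _ _ _ hφ]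
  simp_rw [hsum]
  rw [lintegral_tsum fun n => hφ.lintegral_kernel.aemeasurable, tsum_eq_zero_add' ENNReal.summable]
  simp_rw [hsucc, jumpLaw_zero]

variable [IsFiniteKernel κ]

theorem lintegral_hit (t : ℝ) (u : α) {f : ℝ × α → ℝ≥0∞} (hf : Measurable f) :
    ∫⁻ p, f p ∂hit κ (t, u) =
      ∫⁻ r in Ico 0 t, survival κ u (t - r) * ∫⁻ w, f (r, w) ∂κ u := by
  have hset : MeasurableSet {q : (ℝ × α) × ℝ × α | q.2.1 ∈ Ico 0 q.1.1} :=
    (measurableSet_le (f := fun _ => 0) (g := fun q : (ℝ × α) × ℝ × α => q.2.1)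
      (by fun_prop) (by fun_prop)).inter
    (measurableSet_lt (f := fun q : (ℝ × α) × ℝ × α => q.2.1) (g := fun q => q.1.1)
      (by fun_prop) (by fun_prop))
  have hmeas : Measurable (Function.uncurry fun (p x : ℝ × α) =>
      (Ico 0 p.1).indicator (fun r => survival κ p.2 (p.1 - r)) x.1) :=
    Measurable.indicator (f := fun q : (ℝ × α) × ℝ × α => survival κ q.1.2 (q.1.1 - q.2.1))
      (measurable_survival (by fun_prop) (by fun_prop)) hset
  have hmeas' : Measurable ((Ico 0 t).indicator fun r => survival κ u (t - r)) :=
    (measurable_survival measurable_const (by fun_prop)).indicator measurableSet_Ico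
  rw [hit, Kernel.lintegral_withDensity _ hmeas _ hf, Kernel.prod_apply, Kernel.const_apply,
    Kernel.comap_apply, ← lintegral_indicator measurableSet_Ico]
  refine (lintegral_prod _ ((hmeas'.comp measurable_fst).mul hf).aemeasurable).trans ?_
  refine lintegral_congr fun r => ?_
  rw [indicator_mul_left (f := fun r => survival κ u (t - r))]
  exact lintegral_const_mul ((Ico 0 t).indicator (fun r => survival κ u (t - r)) r)
    (hf.comp measurable_prodMk_left)

theorem lintegral_survival_mul_rate (u : α) {t : ℝ} (ht : 0 ≤ t) :
    ∫⁻ r in Ico 0 t, survival κ u (t - r) * κ u univ =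
      ENNReal.ofReal (1 - Real.exp (-(κ u).real univ * t)) := by
  set q := (κ u).real univ with hq
  have hderiv (r : ℝ) :
      HasDerivAt (fun r => Real.exp (-q * (t - r))) (Real.exp (-q * (t - r)) * q) r := by
    have hlin : HasDerivAt (fun r => -q * (t - r)) q r := by
      simpa using ((hasDerivAt_id r).const_sub t).const_mul (-q)
    exact hlin.exp
  have hcont : Continuous fun r => Real.exp (-q * (t - r)) * q := by fun_prop
  calc ∫⁻ r in Ico 0 t, survival κ u (t - r) * κ u univ
      = ∫⁻ r in Ico 0 t, ENNReal.ofReal (Real.exp (-q * (t - r)) * q) := by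
        refine setLIntegral_congr_fun measurableSet_Ico fun r hr => ?_
        rw [survival_of_nonneg u (sub_nonneg.2 hr.2.le), ENNReal.ofReal_mul (Real.exp_pos _).le,
          hq, ofReal_measureReal]
    _ = ENNReal.ofReal (∫ r in 0..t, Real.exp (-q * (t - r)) * q) := by
        rw [intervalIntegral.integral_of_le ht, ← integral_Ico_eq_integral_Ioc,
          ofReal_integral_eq_lintegral_ofReal]
        · exact (hcont.integrableOn_Icc).mono_set Ico_subset_Icc_self
        · exact ae_of_all _ fun r => by positivity
    _ = ENNReal.ofReal (1 - Real.exp (-q * t)) := by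
        rw [intervalIntegral.integral_eq_sub_of_hasDerivAt (fun r _ => hderiv r)
          (hcont.intervalIntegrable _ _)]
        simp

theorem stay_univ_add_hit_univ (p : ℝ × α) : stay κ p univ + hit κ p univ = 1 := by
  obtain ⟨t, u⟩ := p
  have hhit : hit κ (t, u) univ = ∫⁻ r in Ico 0 t, survival κ u (t - r) * κ u univ := by
    simpa using lintegral_hit (κ := κ) t u (measurable_const (a := 1))
  rw [stay_univ, hhit]
  rcases le_total 0 t with ht | ht
  · have hexp : Real.exp (-(κ u).real univ * t) ≤ 1 :=
      Real.exp_le_one_iff.2 (mul_nonpos_of_nonpos_of_nonneg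
        (neg_nonpos.2 measureReal_nonneg) ht)
    rw [lintegral_survival_mul_rate u ht, survival_of_nonneg u ht,
      ← ENNReal.ofReal_add (Real.exp_pos _).le (sub_nonneg.2 hexp)]
    simp
  · simp [survival, ht]

theorem hit_univ_le {Λ : ℝ} (hΛ : ∀ u, (κ u).real univ ≤ Λ) {t T : ℝ} (hT : 0 ≤ T) (ht : t ≤ T)
    (u : α) : hit κ (t, u) univ ≤ 1 - ENNReal.ofReal (Real.exp (-Λ * T)) := by
  have hsurvival : ENNReal.ofReal (Real.exp (-Λ * T)) ≤ survival κ u t := by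
    have hmul : (κ u).real univ * max t 0 ≤ Λ * T :=
      mul_le_mul (hΛ u) (max_le ht hT) (le_max_right _ _) (measureReal_nonneg.trans (hΛ u))
    exact ENNReal.ofReal_le_ofReal (Real.exp_le_exp.2 (by linarith))
  refine ENNReal.le_sub_of_add_le_right ENNReal.ofReal_ne_top ?_
  calc hit κ (t, u) univ + ENNReal.ofReal (Real.exp (-Λ * T))
      ≤ hit κ (t, u) univ + survival κ u t := by gcongr
    _ = 1 := by rw [← stay_univ, add_comm, stay_univ_add_hit_univ]

theorem hit_pow_univ_le {Λ : ℝ} (hΛ : ∀ u, (κ u).real univ ≤ Λ) {T : ℝ} (hT : 0 ≤ T) (n : ℕ)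
    {t : ℝ} (ht : t ≤ T) (u : α) :
    (hit κ ^ n) (t, u) univ ≤ (1 - ENNReal.ofReal (Real.exp (-Λ * T))) ^ n := by
  set c := 1 - ENNReal.ofReal (Real.exp (-Λ * T))
  induction n generalizing t u with
  | zero => simp [show (1 : Kernel (ℝ × α) (ℝ × α)) = Kernel.id from rfl, Kernel.id_apply]
  | succ n ih =>
    calc (hit κ ^ (n + 1)) (t, u) univ
        = ∫⁻ x, (hit κ ^ n) x univ ∂hit κ (t, u) := by
          rw [pow_succ]
          exact Kernel.comp_apply' _ _ _ .univ
      _ = ∫⁻ r in Ico 0 t, survival κ u (t - r) * ∫⁻ w, (hit κ ^ n) (r, w) univ ∂κ u :=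
          lintegral_hit t u (Kernel.measurable_coe _ .univ)
      _ ≤ ∫⁻ r in Ico 0 t, survival κ u (t - r) * ∫⁻ _, c ^ n ∂κ u := by
          refine setLIntegral_mono' measurableSet_Ico fun r hr => ?_
          gcongr with w
          exact ih (hr.2.le.trans ht) w
      _ = c ^ n * hit κ (t, u) univ := by
          rw [← lintegral_hit t u measurable_const, lintegral_const]
      _ ≤ c ^ (n + 1) := by
          rw [pow_succ]
          gcongr
          exact hit_univ_le hΛ hT ht u

theorem tendsto_hit_pow_univ (p : ℝ × α) :
    Tendsto (fun n => (hit κ ^ n) p univ) atTop (𝓝 0) := by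
  have hΛ (u : α) : (κ u).real univ ≤ κ.bound.toReal :=
    ENNReal.toReal_mono κ.bound_lt_top.ne (κ.measure_le_bound u univ)
  have hbound (n : ℕ) := hit_pow_univ_le hΛ (le_max_right p.1 0) n (le_max_left p.1 0) p.2
  refine tendsto_of_tendsto_of_tendsto_of_le_of_le tendsto_const_nhds
    (ENNReal.tendsto_pow_atTop_nhds_zero_of_lt_one ?_) (fun _ => zero_le) hbound
  exact ENNReal.sub_lt_self ENNReal.one_ne_top one_ne_zero
    (ENNReal.ofReal_pos.2 (Real.exp_pos _)).ne'

/- Iterating the equation for `h` leaves, after `N` steps, a remainder at most the probability of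
`N` jumps, which tends to `0`. -/
theorem eq_lintegral_law {φ : α → ℝ≥0∞} (hφ : Measurable φ) {h : ℝ × α → ℝ≥0∞}
    (hh : Measurable h) (hone : ∀ p, h p ≤ 1)
    (heq : ∀ p, h p = ∫⁻ w, φ w ∂stay κ p + ∫⁻ x, h x ∂hit κ p) (p : ℝ × α) :
    h p = ∫⁻ w, φ w ∂law κ p := by
  have hiter (N : ℕ) : h p = ∑ n ∈ Finset.range N, ∫⁻ w, φ w ∂jumpLaw κ n p +
      ∫⁻ x, h x ∂(hit κ ^ N) p := by
    induction N with
    | zero => simp [show (1 : Kernel (ℝ × α) (ℝ × α)) = Kernel.id from rfl,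
        Kernel.id_apply, lintegral_dirac' _ hh]
    | succ N ih =>
      have hlast : ∫⁻ x, h x ∂(hit κ ^ N) p =
          ∫⁻ w, φ w ∂jumpLaw κ N p + ∫⁻ x, h x ∂(hit κ ^ (N + 1)) p := by
        have hmul : hit κ ^ (N + 1) = hit κ ∘ₖ (hit κ ^ N) := pow_succ' (hit κ) N
        rw [lintegral_congr heq, lintegral_add_left hφ.lintegral_kernel, hmul, jumpLaw,
          Kernel.lintegral_comp _ _ _ hφ, Kernel.lintegral_comp _ _ _ hh]
      rw [Finset.sum_range_succ, add_assoc, ← hlast]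
      exact ih
  have hrest : Tendsto (fun N => ∫⁻ x, h x ∂(hit κ ^ N) p) atTop (𝓝 0) :=
    tendsto_of_tendsto_of_tendsto_of_le_of_le tendsto_const_nhds (tendsto_hit_pow_univ (κ := κ) p)
      (fun _ => zero_le) fun N => (lintegral_mono hone).trans_eq (by simp)
  have hsum := (ENNReal.summable.hasSum (f := fun n => ∫⁻ w, φ w ∂jumpLaw κ n p)).tendsto_sum_nat
  rw [law, Kernel.sum_apply, lintegral_sum_measure]
  have hlim := hsum.add hrest
  simp only [← hiter, add_zero] at hlim
  exact tendsto_nhds_unique tendsto_const_nhds hlim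

instance : IsMarkovKernel (law κ) := by
  refine ⟨fun p => ⟨?_⟩⟩
  have h := eq_lintegral_law (κ := κ) measurable_one (h := fun _ => 1) measurable_const
    (fun _ => le_rfl) (fun p => ?_) p
  · simpa using h.symm
  · simpa using (stay_univ_add_hit_univ p).symm

instance (t : ℝ) : IsMarkovKernel (semigroup κ t) := by
  rw [semigroup]
  infer_instance

theorem law_apply_of_rate_eq_zero {A : Set α} (hA : MeasurableSet A) (hnull : ∀ u, κ u A = 0)
    (p : ℝ × α) : law κ p A = stay κ p A := by
  rw [← lintegral_indicator_one hA]
  refine (eq_lintegral_law (measurable_one.indicator hA) (Kernel.measurable_coe _ hA)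
    (fun q => ?_) (fun q => ?_) p).symm
  · calc stay κ q A ≤ stay κ q univ + hit κ q univ :=
          (measure_mono (subset_univ A)).trans le_self_add
      _ = 1 := stay_univ_add_hit_univ q
  · have hzero (t : ℝ) (u : α) : ∫⁻ w, stay κ (t, w) A ∂κ u = 0 := by
      refine lintegral_eq_zero_of_ae_eq_zero ?_
      filter_upwards [measure_eq_zero_iff_ae_notMem.1 (hnull u)] with w hw
      rw [← lintegral_indicator_one hA, lintegral_stay t w (measurable_one.indicator hA)]
      simp [hw]
    obtain ⟨t, u⟩ := q
    rw [lintegral_hit t u (Kernel.measurable_coe _ hA)]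
    simp [hzero, lintegral_indicator_one hA]

theorem smul_le_semigroup_one {Λ : ℝ} (hΛ : ∀ u, (κ u).real univ ≤ Λ) (u : α) :
    ENNReal.ofReal (Real.exp (-Λ)) • κ u ≤ semigroup κ 1 u := by
  have hsurvival (w : α) {t : ℝ} (ht : 0 ≤ t) :
      ENNReal.ofReal (Real.exp (-Λ * t)) ≤ survival κ w t := by
    rw [survival_of_nonneg w ht]
    exact ENNReal.ofReal_le_ofReal (Real.exp_le_exp.2
      (mul_le_mul_of_nonneg_right (neg_le_neg (hΛ w)) ht))
  refine Measure.le_iff.2 fun A hA => ?_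
  calc ENNReal.ofReal (Real.exp (-Λ)) * κ u A
      = ∫⁻ _ in Ico (0 : ℝ) 1, ENNReal.ofReal (Real.exp (-Λ)) * κ u A := by simp
    _ ≤ ∫⁻ r in Ico (0 : ℝ) 1, survival κ u (1 - r) * ∫⁻ w, stay κ (r, w) A ∂κ u := by
        refine setLIntegral_mono' measurableSet_Ico fun r hr => ?_
        calc ENNReal.ofReal (Real.exp (-Λ)) * κ u A
            = ENNReal.ofReal (Real.exp (-Λ * (1 - r))) *
                ∫⁻ w, ENNReal.ofReal (Real.exp (-Λ * r)) * A.indicator 1 w ∂κ u := by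
              rw [lintegral_const_mul _ (measurable_one.indicator hA), lintegral_indicator_one hA,
                ← mul_assoc, ← ENNReal.ofReal_mul (Real.exp_pos _).le, ← Real.exp_add]
              ring_nf
          _ ≤ survival κ u (1 - r) * ∫⁻ w, stay κ (r, w) A ∂κ u := by
              gcongr with w
              · exact hsurvival u (sub_nonneg.2 hr.2.le)
              · rw [← lintegral_indicator_one hA, lintegral_stay r w (measurable_one.indicator hA)]
                gcongr
                exact hsurvival w hr.1
    _ = ∫⁻ x, stay κ x A ∂hit κ (1, u) := (lintegral_hit 1 u (Kernel.measurable_coe _ hA)).symm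
    _ = jumpLaw κ 1 (1, u) A := by
        rw [jumpLaw_succ, jumpLaw_zero, Kernel.comp_apply' _ _ _ hA]
    _ ≤ semigroup κ 1 u A := by
        rw [semigroup, Kernel.comap_apply, law, Kernel.sum_apply' _ _ hA]
        exact ENNReal.le_tsum 1

theorem lintegral_law_add {s t : ℝ} (hs : 0 ≤ s) (ht : 0 ≤ t) (u : α) {φ : α → ℝ≥0∞}
    (hφ : Measurable φ) :
    ∫⁻ w, φ w ∂law κ (s + t, u) = survival κ u s * ∫⁻ w, φ w ∂law κ (t, u) +
      ∫⁻ r in Ico 0 s, survival κ u (s - r) * ∫⁻ w, ∫⁻ y, φ y ∂law κ (r + t, w) ∂κ u := by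
  have hmeas : Measurable fun x => ∫⁻ y, φ y ∂law κ x := hφ.lintegral_kernel
  set g : ℝ → ℝ≥0∞ := fun r => ∫⁻ w, ∫⁻ y, φ y ∂law κ (r, w) ∂κ u
  have hgmeas : Measurable g := hmeas.lintegral_prod_right'
  have hlate : ∫⁻ r in Ico t (s + t), survival κ u (s + t - r) * g r =
      ∫⁻ r in Ico 0 s, survival κ u (s - r) * g (r + t) := by
    rw [← lintegral_indicator measurableSet_Ico, ← lintegral_indicator measurableSet_Ico,
      ← lintegral_add_right_eq_self _ t]
    refine lintegral_congr fun r => ?_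
    simp only [indicator, mem_Ico, le_add_iff_nonneg_left, add_lt_add_iff_right,
      add_sub_add_right_eq_sub]
  have hearly : ∫⁻ r in Ico 0 t, survival κ u (s + t - r) * g r =
      survival κ u s * ∫⁻ r in Ico 0 t, survival κ u (t - r) * g r := by
    have hdelay : Measurable fun r => survival κ u (t - r) * g r :=
      (measurable_survival measurable_const (by fun_prop)).mul hgmeas
    rw [← lintegral_const_mul _ hdelay]
    refine setLIntegral_congr_fun measurableSet_Ico fun r hr => ?_
    rw [add_sub_assoc, survival_add u hs (sub_nonneg.2 hr.2.le), mul_assoc]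
  have hsplit : Ico 0 (s + t) = Ico 0 t ∪ Ico t (s + t) :=
    (Ico_union_Ico_eq_Ico ht (le_add_of_nonneg_left hs)).symm
  rw [lintegral_law (s + t, u) hφ, lintegral_law (t, u) hφ, lintegral_stay _ _ hφ,
    lintegral_stay _ _ hφ, lintegral_hit _ _ hmeas, lintegral_hit _ _ hmeas, hsplit,
    lintegral_union measurableSet_Ico Ico_disjoint_Ico_same, hlate, hearly, mul_add, ← mul_assoc,
    ← survival_add u hs ht, add_assoc]

theorem semigroup_add {s t : ℝ} (hs : 0 ≤ s) (ht : 0 ≤ t) :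
    semigroup κ (s + t) = semigroup κ t ∘ₖ semigroup κ s := by
  ext u A hA
  have hmeas : Measurable fun p : ℝ × α => law κ (max p.1 0 + t, p.2) A :=
    (Kernel.measurable_coe _ hA).comp (by fun_prop)
  have hmeas' : Measurable fun w => law κ (t, w) A :=
    (Kernel.measurable_coe _ hA).comp measurable_prodMk_left
  have hrenewal (p : ℝ × α) : law κ (max p.1 0 + t, p.2) A =
      ∫⁻ w, law κ (t, w) A ∂stay κ p + ∫⁻ x, law κ (max x.1 0 + t, x.2) A ∂hit κ p := by
    obtain ⟨s, u⟩ := p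
    rw [lintegral_stay s u hmeas', lintegral_hit s u hmeas]
    rcases le_total 0 s with hs | hs
    · have h := lintegral_law_add (κ := κ) hs ht u (measurable_one.indicator hA)
      simp only [lintegral_indicator_one hA] at h
      rw [max_eq_left hs, h]
      congr 1
      refine setLIntegral_congr_fun measurableSet_Ico fun r hr => ?_
      simp only [max_eq_left hr.1]
    · simp [survival, hs]
  have h := eq_lintegral_law hmeas' hmeas (fun _ => prob_le_one) hrenewal (s, u)
  rw [Kernel.comp_apply' _ _ _ hA]
  simpa [hs, semigroup] using h

end JumpProcess

end

namespace PistonModel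

variable (G : PistonModel)

/-- The weight of the piston velocity in an elastic collision. -/
noncomputable def keep : ℝ := (G.M - G.m) / (G.M + G.m)

/-- The weight of the atom velocity in an elastic collision. -/
noncomputable def kick : ℝ := 2 * G.m / (G.M + G.m)

theorem collide_eq (u v : ℝ) : G.collide u v = G.keep * u + G.kick * v := rfl

theorem keep_pos : 0 < G.keep :=
  div_pos (sub_pos.2 G.m_lt_M) (add_pos (G.m_pos.trans G.m_lt_M) G.m_pos)

theorem kick_pos : 0 < G.kick :=
  div_pos (mul_pos two_pos G.m_pos) (add_pos (G.m_pos.trans G.m_lt_M) G.m_pos)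

theorem keep_add_kick : G.keep + G.kick = 1 := by
  have h : G.M + G.m ≠ 0 := (add_pos (G.m_pos.trans G.m_lt_M) G.m_pos).ne'
  unfold keep kick
  field_simp
  ring

theorem keep_lt_one : G.keep < 1 := by
  linarith [G.keep_add_kick, G.kick_pos]

theorem Vbar_lt_vmin : G.Vbar < G.vmin := by
  have hm := G.m_pos
  have hM := G.m_lt_M
  refine G.Vbar_lt.trans_le (mul_le_of_le_one_left G.vmin_pos.le ?_)
  rw [div_le_one (by linarith)]
  linarith

theorem reflect_of_mem {w : ℝ} (hw : w ∈ G.states) : G.reflect w = w := by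
  unfold reflect
  rw [if_neg (not_lt.2 hw.2), if_neg (not_lt.2 hw.1)]

theorem lipschitzWith_reflect : LipschitzWith 1 G.reflect := by
  refine LipschitzWith.mk_one fun w w' => ?_
  have h := G.Vbar_pos
  rw [Real.dist_eq, Real.dist_eq]
  unfold reflect
  rcases abs_cases (w - w') with ⟨e, _⟩ | ⟨e, _⟩ <;> rw [e, abs_le] <;> split_ifs <;>
    constructor <;> linarith

theorem reflect_mem_states {w : ℝ} (hw : |w| ≤ 3 * G.Vbar) : G.reflect w ∈ G.states := by
  have h := G.Vbar_pos
  rw [abs_le] at hw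
  unfold reflect states
  split_ifs <;> constructor <;> linarith

theorem continuous_jump : Continuous fun p : ℝ × ℝ => G.jump p.1 p.2 :=
  G.lipschitzWith_reflect.continuous.comp <| by unfold collide; fun_prop

theorem measurable_jump : Measurable fun p : ℝ × ℝ => G.jump p.1 p.2 :=
  G.continuous_jump.measurable

theorem dist_jump_le (u u' v : ℝ) : dist (G.jump u v) (G.jump u' v) ≤ G.keep * dist u u' := by
  refine (G.lipschitzWith_reflect.dist_le_mul _ _).trans_eq ?_
  rw [NNReal.coe_one, one_mul, collide_eq, collide_eq, dist_add_right, dist_eq_norm, ← mul_sub,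
    norm_mul, Real.norm_of_nonneg G.keep_pos.le, dist_eq_norm]

/-- The hypothesis that a single reflection returns the velocity to the state space. -/
def SingleReflection : Prop :=
  (G.M - G.m) / (G.M + G.m) * G.Vbar + 2 * G.m / (G.M + G.m) * G.vmax ≤ 3 * G.Vbar

variable {G} in
theorem SingleReflection.jump_mem (h : G.SingleReflection) {u v : ℝ} (hu : u ∈ G.states)
    (hv : |v| ≤ G.vmax) : G.jump u v ∈ G.states := by
  refine G.reflect_mem_states ?_
  calc |G.keep * u + G.kick * v| ≤ |G.keep * u| + |G.kick * v| := abs_add_le _ _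
    _ = G.keep * |u| + G.kick * |v| := by
      rw [abs_mul, abs_mul, abs_of_pos G.keep_pos, abs_of_pos G.kick_pos]
    _ ≤ G.keep * G.Vbar + G.kick * G.vmax :=
      add_le_add (mul_le_mul_of_nonneg_left (abs_le.2 hu) G.keep_pos.le)
        (mul_le_mul_of_nonneg_left hv G.kick_pos.le)
    _ ≤ 3 * G.Vbar := h

theorem measurable_rate : Measurable fun p : ℝ × ℝ => G.rate p.1 p.2 := by
  have hL := G.fL_measurable
  have hR := G.fR_measurable
  unfold rate
  refine Measurable.ite (measurableSet_lt measurable_const measurable_snd) ?_ ?_ <;> fun_prop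

theorem rate_ne_top (u v : ℝ) : G.rate u v ≠ ∞ := by
  unfold rate
  split_ifs <;> exact ENNReal.ofReal_ne_top

theorem rate_eq_zero {u v : ℝ} (hv : G.vmax ≤ |v|) : G.rate u v = 0 := by
  simp only [rate, G.fL_cutoff v (.inr hv), G.fR_cutoff v (.inr hv), mul_zero,
    ENNReal.ofReal_zero, ite_self]

theorem rate_le {u v : ℝ} (hu : u ∈ G.states) : G.rate u v ≤ ENNReal.ofReal (G.Vbar + G.vmax) *
    (ENNReal.ofReal G.nL * ENNReal.ofReal (G.fL v) +
      ENNReal.ofReal G.nR * ENNReal.ofReal (G.fR v)) := by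
  rcases le_or_gt G.vmax |v| with hv | hv
  · rw [G.rate_eq_zero hv]
    exact zero_le
  have hspeed := abs_lt.1 hv
  rw [← ENNReal.ofReal_mul G.nL_pos.le, ← ENNReal.ofReal_mul G.nR_pos.le, mul_add]
  unfold rate
  split_ifs
  · rw [ENNReal.ofReal_mul' (mul_nonneg G.nL_pos.le (G.fL_nonneg v))]
    exact le_add_right (mul_le_mul_left (ENNReal.ofReal_le_ofReal (by linarith [hu.1])) _)
  · rw [ENNReal.ofReal_mul' (mul_nonneg G.nR_pos.le (G.fR_nonneg v))]
    exact le_add_left (mul_le_mul_left (ENNReal.ofReal_le_ofReal (by linarith [hu.2])) _)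

/-- An upper bound for the total collision rate on the state space. -/
def maxRate : ℝ := (G.Vbar + G.vmax) * (G.nL + G.nR)

theorem maxRate_nonneg : 0 ≤ G.maxRate :=
  mul_nonneg (add_pos G.Vbar_pos (G.vmin_pos.trans G.vmin_lt_vmax)).le
    (add_pos G.nL_pos G.nR_pos).le

theorem lintegral_rate_le {u : ℝ} (hu : u ∈ G.states) :
    ∫⁻ v, G.rate u v ≤ ENNReal.ofReal G.maxRate := by
  have hL := G.fL_measurable
  have hR := G.fR_measurable
  refine (lintegral_mono fun v => G.rate_le hu).trans_eq ?_
  rw [lintegral_const_mul _ (by fun_prop), lintegral_add_left (by fun_prop),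
    lintegral_const_mul _ (by fun_prop), lintegral_const_mul _ (by fun_prop), G.fL_prob, G.fR_prob,
    mul_one, mul_one, ← ENNReal.ofReal_add G.nL_pos.le G.nR_pos.le,
    ← ENNReal.ofReal_mul' (add_pos G.nL_pos G.nR_pos).le, maxRate]

/-- A compact set of atom velocities, charging both half-lines, on which the collision rates of all
states are bounded below by `c`. -/
structure IsCore (K : Set ℝ) (c : ℝ≥0∞) : Prop where
  isCompact : IsCompact K
  ne_zero : c ≠ 0
  abs_mem : ∀ v ∈ K, |v| ∈ Ioo G.vmin G.vmax
  le_rate : ∀ u ∈ G.states, ∀ v ∈ K, c ≤ G.rate u v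
  volume_Ioi_pos : 0 < volume (K ∩ Ioi 0)
  volume_Iio_pos : 0 < volume (K ∩ Iio 0)

theorem le_rate_of_pos {u v : ℝ} {c : ℝ≥0∞} (hu : u ∈ G.states) (hv : G.vmin < v)
    (hc : c ≤ ENNReal.ofReal (G.fL v)) :
    ENNReal.ofReal (G.vmin - G.Vbar) * (ENNReal.ofReal G.nL * c) ≤ G.rate u v := by
  have hspeed : G.vmin - G.Vbar ≤ v - u := by linarith [hu.2]
  rw [rate, if_pos (G.vmin_pos.trans hv),
    ENNReal.ofReal_mul' (mul_nonneg G.nL_pos.le (G.fL_nonneg v)), ENNReal.ofReal_mul G.nL_pos.le]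
  gcongr

theorem le_rate_of_neg {u v : ℝ} {c : ℝ≥0∞} (hu : u ∈ G.states) (hv : v < -G.vmin)
    (hc : c ≤ ENNReal.ofReal (G.fR v)) :
    ENNReal.ofReal (G.vmin - G.Vbar) * (ENNReal.ofReal G.nR * c) ≤ G.rate u v := by
  have hspeed : G.vmin - G.Vbar ≤ u - v := by linarith [hu.1]
  rw [rate, if_neg (by linarith [G.vmin_pos]),
    ENNReal.ofReal_mul' (mul_nonneg G.nR_pos.le (G.fR_nonneg v)), ENNReal.ofReal_mul G.nR_pos.le]
  gcongr

theorem exists_isCore : ∃ K c, G.IsCore K c := by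
  have hspeed {f : ℝ → ℝ} (hf : ∀ v, |v| ≤ G.vmin ∨ G.vmax ≤ |v| → f v = 0) {v : ℝ} {c : ℝ≥0∞}
      (hc : c ≠ 0) (h : c ≤ ENNReal.ofReal (f v)) : |v| ∈ Ioo G.vmin G.vmax := by
    by_contra hv
    rw [mem_Ioo, not_and_or, not_lt, not_lt] at hv
    rw [hf v hv, ENNReal.ofReal_zero, nonpos_iff_eq_zero] at h
    exact hc h
  have hright : ∫⁻ v in Ioi 0, ENNReal.ofReal (G.fL v) ≠ 0 :=
    setLIntegral_Ioi_ne_zero_of_even (fun v => by rw [G.fL_even]) (by simp [G.fL_prob])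
  have hleft : ∫⁻ v in Iio 0, ENNReal.ofReal (G.fR v) ≠ 0 := by
    have heven (v : ℝ) : ENNReal.ofReal (G.fR (-v)) = ENNReal.ofReal (G.fR v) := by rw [G.fR_even]
    rw [setLIntegral_Iio_eq_setLIntegral_Ioi_of_even heven]
    exact setLIntegral_Ioi_ne_zero_of_even heven (by simp [G.fR_prob])
  obtain ⟨K, hKs, hK, hKpos, c, hc, hcK⟩ := exists_isCompact_le_of_setLIntegral_ne_zero
    G.fL_measurable.ennreal_ofReal measurableSet_Ioi hright
  obtain ⟨K', hKs', hK', hKpos', c', hc', hcK'⟩ := exists_isCompact_le_of_setLIntegral_ne_zero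
    G.fR_measurable.ennreal_ofReal measurableSet_Iio hleft
  have hgap : ENNReal.ofReal (G.vmin - G.Vbar) ≠ 0 := by simp [G.Vbar_lt_vmin]
  refine ⟨K ∪ K', min (ENNReal.ofReal (G.vmin - G.Vbar) * (ENNReal.ofReal G.nL * c))
    (ENNReal.ofReal (G.vmin - G.Vbar) * (ENNReal.ofReal G.nR * c')), hK.union hK', ?_, ?_, ?_,
    hKpos.trans_le (measure_mono (subset_inter subset_union_left hKs)),
    hKpos'.trans_le (measure_mono (subset_inter subset_union_right hKs'))⟩
  · exact (lt_min (by simp [pos_iff_ne_zero, hgap, hc, G.nL_pos])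
      (by simp [pos_iff_ne_zero, hgap, hc', G.nR_pos])).ne'
  · rintro v (hv | hv)
    · exact hspeed G.fL_cutoff hc (hcK v hv)
    · exact hspeed G.fR_cutoff hc' (hcK' v hv)
  · rintro u hu v (hv | hv)
    · have habs := (hspeed G.fL_cutoff hc (hcK v hv)).1
      rw [abs_of_pos (hKs hv)] at habs
      exact (min_le_left _ _).trans (G.le_rate_of_pos hu habs (hcK v hv))
    · have habs := (hspeed G.fR_cutoff hc' (hcK' v hv)).1
      rw [abs_of_neg (hKs' hv)] at habs
      exact (min_le_right _ _).trans (G.le_rate_of_neg hu (lt_neg.1 habs) (hcK' v hv))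

end PistonModel

section

open ProbabilityTheory JumpProcess

namespace PistonModel

variable (G : PistonModel)

/-- The velocity after a collision, as an element of the state space. The projection only matters
for atoms of speed above `vmax`, which have rate zero, once `SingleReflection` holds. -/
noncomputable def jumpState (u : G.states) (v : ℝ) : G.states :=
  projIcc (-G.Vbar) G.Vbar (neg_le_self G.Vbar_pos.le) (G.jump u v)

theorem measurable_jumpState : Measurable fun p : G.states × ℝ => G.jumpState p.1 p.2 :=
  (measurable_const.max (measurable_const.min (G.measurable_jump.comp
    (measurable_subtype_coe.prodMap measurable_id)))).subtype_mk

theorem measurable_jumpState_right (u : G.states) : Measurable (G.jumpState u) :=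
  G.measurable_jumpState.comp measurable_prodMk_left

theorem dist_jumpState_le (u u' : G.states) (v : ℝ) :
    dist (G.jumpState u v) (G.jumpState u' v) ≤ G.keep * dist u u' := by
  have hproj := LipschitzWith.projIcc (neg_le_self G.Vbar_pos.le)
  refine (hproj.dist_le_mul (G.jump u v) (G.jump u' v)).trans ?_
  rw [NNReal.coe_one, one_mul]
  exact G.dist_jump_le u u' v

variable {G} in
theorem SingleReflection.coe_jumpState (h : G.SingleReflection) (u : G.states) {v : ℝ}
    (hv : |v| ≤ G.vmax) : (G.jumpState u v : ℝ) = G.jump u v :=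
  congrArg Subtype.val (projIcc_of_mem _ (h.jump_mem u.2 hv))

/-- The kernel on the state space sending `u` to the law of the next velocity times the total
collision rate. -/
noncomputable def rateKernel : Kernel G.states G.states :=
  (Kernel.id ×ₖ (Kernel.const G.states volume).withDensity fun u v => G.rate u v).map
    fun p => G.jumpState p.1 p.2

theorem lintegral_rateKernel (u : G.states) {f : G.states → ℝ≥0∞} (hf : Measurable f) :
    ∫⁻ w, f w ∂G.rateKernel u = ∫⁻ v, G.rate u v * f (G.jumpState u v) := by
  have hrate : Measurable (Function.uncurry fun (u : G.states) (v : ℝ) => G.rate u v) :=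
    G.measurable_rate.comp (measurable_subtype_coe.prodMap measurable_id)
  have hjump := G.measurable_jumpState
  have hatoms := Kernel.IsSFiniteKernel.withDensity (Kernel.const G.states (volume : Measure ℝ))
    fun (u : G.states) (v : ℝ) => G.rate_ne_top u v
  rw [rateKernel, Kernel.lintegral_map _ hjump _ hf,
    Kernel.lintegral_id_prod (f := fun p => f (G.jumpState p.1 p.2)) (hf.comp hjump),
    Kernel.withDensity_apply _ hrate, Kernel.const_apply,
    lintegral_withDensity_eq_lintegral_mul _ hrate.of_uncurry_left
      (g := fun v => f (G.jumpState u v)) (hf.comp (hjump.comp measurable_prodMk_left))]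
  rfl

theorem rateKernel_univ (u : G.states) : G.rateKernel u univ = ∫⁻ v, G.rate u v := by
  rw [← lintegral_one, G.lintegral_rateKernel u measurable_const]
  simp only [mul_one]

theorem measureReal_rateKernel_univ (u : G.states) :
    (G.rateKernel u).real univ = G.totalRate u := by
  rw [measureReal_def, rateKernel_univ, totalRate]

instance : IsFiniteKernel G.rateKernel :=
  ⟨ENNReal.ofReal G.maxRate, ENNReal.ofReal_lt_top, fun u =>
    (G.rateKernel_univ u).trans_le (G.lintegral_rate_le u.2)⟩

theorem measureReal_rateKernel_univ_le (u : G.states) :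
    (G.rateKernel u).real univ ≤ G.maxRate :=
  ENNReal.toReal_le_of_le_ofReal G.maxRate_nonneg
    ((G.rateKernel_univ u).trans_le (G.lintegral_rate_le u.2))

variable {G}

theorem SingleReflection.transN_eq (h : G.SingleReflection) (n : ℕ) {t : ℝ} (ht : 0 ≤ t)
    (u : G.states) {A : Set ℝ} (hA : MeasurableSet A) :
    G.transN n t u A = jumpLaw G.rateKernel n (t, u) ((↑) ⁻¹' A) := by
  have hA' : MeasurableSet ((↑) ⁻¹' A : Set G.states) := measurable_subtype_coe hA
  induction n generalizing t u with
  | zero =>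
    rw [jumpLaw_zero, ← lintegral_indicator_one hA',
      lintegral_stay t u (measurable_one.indicator hA'), survival_of_nonneg u ht,
      measureReal_rateKernel_univ, transN]
    rfl
  | succ n ih =>
    have hmeas : Measurable fun x => jumpLaw G.rateKernel n x ((↑) ⁻¹' A) :=
      Kernel.measurable_coe _ hA'
    have hlast (s : ℝ) (hs : s ∈ Ioc 0 t) :
        ∫⁻ v, G.rate u v * G.transN n (t - s) (G.jump u v) A
          = ∫⁻ w, jumpLaw G.rateKernel n (t - s, w) ((↑) ⁻¹' A) ∂G.rateKernel u := by
      rw [G.lintegral_rateKernel u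
        (f := fun w => jumpLaw G.rateKernel n (t - s, w) ((↑) ⁻¹' A)) (by fun_prop)]
      refine lintegral_congr fun v => ?_
      rcases le_or_gt G.vmax |v| with hv | hv
      · rw [G.rate_eq_zero hv, zero_mul, zero_mul]
      · rw [← h.coe_jumpState u hv.le, ih (sub_nonneg.2 hs.2)]
    rw [jumpLaw_succ, Kernel.comp_apply' _ _ _ hA', lintegral_hit t u hmeas, transN,
      ← setLIntegral_Ioc_comp_sub_left]
    refine setLIntegral_congr_fun measurableSet_Ioc fun s hs => ?_
    rw [hlast s hs, sub_sub_cancel, survival_of_nonneg u hs.1.le, measureReal_rateKernel_univ]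

theorem SingleReflection.trans_eq (h : G.SingleReflection) {t : ℝ} (ht : 0 ≤ t)
    (u : G.states) {A : Set ℝ} (hA : MeasurableSet A) :
    G.trans t u A = semigroup G.rateKernel t u ((↑) ⁻¹' A) := by
  rw [semigroup, Kernel.comap_apply, law, Kernel.sum_apply' _ _ (measurable_subtype_coe hA), trans]
  exact tsum_congr fun n => h.transN_eq n ht u hA

theorem IsDistribution.ae_mem {ν : Measure ℝ} (hν : G.IsDistribution ν) : ∀ᵐ u ∂ν, u ∈ G.states :=
  hν.2

variable (G) in
theorem measurableSet_states : MeasurableSet G.states := measurableSet_Icc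

theorem IsDistribution.map_comap {ν : Measure ℝ} (hν : G.IsDistribution ν) :
    (ν.comap ((↑) : G.states → ℝ)).map (↑) = ν := by
  rw [(MeasurableEmbedding.subtype_coe G.measurableSet_states).map_comap, Subtype.range_coe]
  exact Measure.restrict_eq_self_of_ae_mem hν.ae_mem

theorem IsDistribution.isProbabilityMeasure_comap {ν : Measure ℝ} (hν : G.IsDistribution ν) :
    IsProbabilityMeasure (ν.comap ((↑) : G.states → ℝ)) := by
  have := hν.1
  refine (MeasurableEmbedding.subtype_coe G.measurableSet_states).isProbabilityMeasure_comap ?_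
  rw [Subtype.range_coe]
  exact hν.ae_mem

theorem isDistribution_map (π : Measure G.states) [IsProbabilityMeasure π] :
    G.IsDistribution (π.map (↑)) := by
  refine ⟨Measure.isProbabilityMeasure_map measurable_subtype_coe.aemeasurable, ?_⟩
  rw [Measure.map_apply measurable_subtype_coe G.measurableSet_states.compl]
  simp

theorem comap_map (π : Measure G.states) : (π.map ((↑) : G.states → ℝ)).comap (↑) = π :=
  (MeasurableEmbedding.subtype_coe G.measurableSet_states).comap_map π

theorem SingleReflection.evolve_eq (h : G.SingleReflection) {ν : Measure ℝ}
    (hν : G.IsDistribution ν) {t : ℝ} (ht : 0 ≤ t) {A : Set ℝ} (hA : MeasurableSet A) :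
    G.evolve ν t A = (semigroup G.rateKernel t ∘ₘ ν.comap (↑)) ((↑) ⁻¹' A) := by
  rw [Measure.bind_apply (measurable_subtype_coe hA) (Kernel.aemeasurable _), evolve,
    ← Measure.restrict_eq_self_of_ae_mem hν.ae_mem,
    ← lintegral_subtype_comap G.measurableSet_states,
    Measure.restrict_eq_self_of_ae_mem hν.ae_mem]
  exact lintegral_congr fun u => h.trans_eq ht u hA

theorem SingleReflection.isStationary_iff (h : G.SingleReflection) {μ : Measure ℝ} :
    G.IsStationary μ ↔ G.IsDistribution μ ∧
      ∀ t, 0 ≤ t → (semigroup G.rateKernel t).Invariant (μ.comap (↑)) := by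
  refine and_congr_right fun hμ => forall₂_congr fun t ht => ⟨fun hstat => ?_, fun hinv A hA => ?_⟩
  · refine Measure.ext fun B hB => ?_
    have hB' : MeasurableSet ((↑) '' B : Set ℝ) := G.measurableSet_states.subtype_image hB
    have hBeq : ((↑) ⁻¹' ((↑) '' B : Set ℝ) : Set G.states) = B :=
      preimage_image_eq B Subtype.val_injective
    rw [← hBeq, ← h.evolve_eq hμ ht hB', hstat _ hB', hBeq,
      comap_subtype_coe_apply G.measurableSet_states]
  · rw [h.evolve_eq hμ ht hA, hinv, ← Measure.map_apply measurable_subtype_coe hA, hμ.map_comap]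

end PistonModel

end

section

open ProbabilityTheory JumpProcess Pointwise

/-- Any two of the measures `κ u`, `κ u'` with `dist u u' ≤ ρ` have at least the mass `ε` in common:
for probability measures, the infimum over `A` of `κ u A + κ u' Aᶜ` is one minus their total
variation distance. -/
def Overlapping {α : Type*} [PseudoMetricSpace α] [MeasurableSpace α] (κ : Kernel α α) (ρ : ℝ)
    (ε : ℝ≥0∞) : Prop :=
  ∀ u u', dist u u' ≤ ρ → ∀ A, MeasurableSet A → ε ≤ κ u A + κ u' Aᶜ

theorem Overlapping.exists_dobrushinLE {α : Type*} [PseudoMetricSpace α] [MeasurableSpace α]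
    [Nonempty α] {κ : Kernel α α} [IsMarkovKernel κ] {ρ : ℝ} {ε : ℝ≥0∞} (h : Overlapping κ ρ ε)
    (hρ : ∀ u u' : α, dist u u' ≤ ρ) (hε : ε ≠ 0) : ∃ q < 1, DobrushinLE κ q := by
  have hfin : ε ≠ ∞ := by
    obtain ⟨u⟩ := ‹Nonempty α›
    exact ne_top_of_le_ne_top (by finiteness) (h u u (hρ u u) ∅ .empty)
  refine ⟨1 - ε.toReal, by simpa using ENNReal.toReal_pos hε hfin, fun u u' A hA => ?_⟩
  have hle := ENNReal.toReal_mono (by finiteness) (h u' u (hρ u' u) A hA)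
  rw [ENNReal.toReal_add (by finiteness) (by finiteness), ← measureReal_def, ← measureReal_def,
    probReal_compl_eq_one_sub hA] at hle
  linarith

namespace PistonModel

variable {G : PistonModel} {K : Set ℝ} {c : ℝ≥0∞}

theorem IsCore.measurableSet (hK : G.IsCore K c) : MeasurableSet K := hK.isCompact.measurableSet

theorem IsCore.volume_pos (hK : G.IsCore K c) : 0 < volume K :=
  hK.volume_Ioi_pos.trans_le (measure_mono inter_subset_left)

theorem IsCore.le_lintegral_rateKernel (hK : G.IsCore K c) (u : G.states) {f : G.states → ℝ≥0∞}
    (hf : Measurable f) :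
    c * ∫⁻ v in K, f (G.jumpState u v) ≤ ∫⁻ w, f w ∂G.rateKernel u := by
  rw [G.lintegral_rateKernel u hf,
    ← lintegral_const_mul (f := fun v => f (G.jumpState u v)) _
      (hf.comp (G.measurable_jumpState_right u))]
  refine (setLIntegral_mono' hK.measurableSet fun v hv => ?_).trans
    (setLIntegral_le_lintegral K _)
  exact mul_le_mul_left (hK.le_rate u u.2 v hv) _

theorem IsCore.le_lintegral_semigroup (hK : G.IsCore K c) (u : G.states) {f : G.states → ℝ≥0∞}
    (hf : Measurable f) :
    ENNReal.ofReal (Real.exp (-G.maxRate)) * c * ∫⁻ v in K, f (G.jumpState u v) ≤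
      ∫⁻ w, f w ∂semigroup G.rateKernel 1 u := by
  rw [mul_assoc]
  refine (mul_le_mul_right (hK.le_lintegral_rateKernel u hf) _).trans ?_
  rw [← smul_eq_mul, ← lintegral_smul_measure]
  exact lintegral_mono' (smul_le_semigroup_one G.measureReal_rateKernel_univ_le u) le_rfl

theorem IsCore.le_semigroup_one_apply (hK : G.IsCore K c) (u : G.states) {A : Set G.states}
    (hA : MeasurableSet A) :
    ENNReal.ofReal (Real.exp (-G.maxRate)) * c * volume (K ∩ G.jumpState u ⁻¹' A) ≤
      semigroup G.rateKernel 1 u A := by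
  have h := hK.le_lintegral_semigroup u (measurable_one.indicator hA)
  have hpre := G.measurable_jumpState_right u hA
  rw [lintegral_indicator_one hA] at h
  rw [inter_comm, ← Measure.restrict_apply hpre, ← lintegral_indicator_one hpre]
  exact h

theorem IsCore.exp_mul_ne_zero (hK : G.IsCore K c) :
    ENNReal.ofReal (Real.exp (-G.maxRate)) * c ≠ 0 :=
  mul_ne_zero (by simp [Real.exp_pos]) hK.ne_zero

theorem jumpState_eq_jumpState_add (u u' : G.states) (v : ℝ) :
    G.jumpState u' v = G.jumpState u (G.keep * (u' - u) / G.kick + v) := by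
  have hkick := G.kick_pos.ne'
  have hcollide : G.collide u' v = G.collide u (G.keep * (u' - u) / G.kick + v) := by
    rw [collide_eq, collide_eq]
    field_simp
    ring
  rw [jumpState, jump, hcollide]
  rfl

/- Changing the velocity of the piston shifts the velocities of the atoms that lead to a given
outcome, and a small shift of `K` overlaps `K`. -/
theorem IsCore.exists_overlapping_semigroup_one (hK : G.IsCore K c) :
    ∃ ρ > 0, ∃ ε ≠ 0, Overlapping (semigroup G.rateKernel 1) ρ ε := by
  obtain ⟨δ, hδ, hshift⟩ := Metric.eventually_nhds_iff.1
    (eventually_half_measure_le_inter_add_vadd_sdiff (μ := volume) hK.isCompact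
      hK.isCompact.isClosed)
  set w := ENNReal.ofReal (Real.exp (-G.maxRate)) * c
  have hscale : 0 < G.kick / G.keep := div_pos G.kick_pos G.keep_pos
  refine ⟨G.kick / G.keep * (δ / 2), by positivity, w * (volume K / 2),
    mul_ne_zero hK.exp_mul_ne_zero (ENNReal.half_pos hK.volume_pos.ne').ne', ?_⟩
  intro u u' hdist A hA
  set x := G.keep * ((u' : ℝ) - u) / G.kick
  have hx : dist x 0 < δ := by
    rw [Subtype.dist_eq, Real.dist_eq, abs_sub_comm] at hdist
    rw [Real.dist_eq, sub_zero, abs_div, abs_mul, abs_of_pos G.keep_pos, abs_of_pos G.kick_pos]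
    have hkeep := G.keep_pos
    have hkick := G.kick_pos
    calc G.keep * |(u' : ℝ) - u| / G.kick
        ≤ G.keep * (G.kick / G.keep * (δ / 2)) / G.kick := by gcongr
      _ = δ / 2 := by field_simp
      _ < δ := half_lt_self hδ
  have hmoved : K ∩ G.jumpState u' ⁻¹' Aᶜ = -x +ᵥ ((x +ᵥ K) \ G.jumpState u ⁻¹' A) := by
    ext v
    simp [mem_vadd_set_iff_neg_vadd_mem, jumpState_eq_jumpState_add u u', x]
  calc w * (volume K / 2)
      ≤ w * (volume (K ∩ G.jumpState u ⁻¹' A) + volume ((x +ᵥ K) \ G.jumpState u ⁻¹' A)) := by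
        gcongr; exact hshift hx _
    _ = w * volume (K ∩ G.jumpState u ⁻¹' A) + w * volume (K ∩ G.jumpState u' ⁻¹' Aᶜ) := by
        rw [hmoved, measure_vadd, mul_add]
    _ ≤ _ := add_le_add (hK.le_semigroup_one_apply u hA) (hK.le_semigroup_one_apply u' hA.compl)

theorem IsCore.overlapping_semigroup_one_add (hK : G.IsCore K c) {t ρ : ℝ} {ε : ℝ≥0∞} (ht : 0 ≤ t)
    (h : Overlapping (semigroup G.rateKernel t) ρ ε) :
    Overlapping (semigroup G.rateKernel (1 + t)) (ρ / G.keep)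
      (ENNReal.ofReal (Real.exp (-G.maxRate)) * c * (ε * volume K)) := by
  intro u u' hdist A hA
  set w := ENNReal.ofReal (Real.exp (-G.maxRate)) * c
  have hmass (s : G.states) {B : Set G.states} (hB : MeasurableSet B) :
      w * ∫⁻ v in K, semigroup G.rateKernel t (G.jumpState s v) B ≤
        semigroup G.rateKernel (1 + t) s B := by
    rw [semigroup_add zero_le_one ht, Kernel.comp_apply' _ _ _ hB]
    exact hK.le_lintegral_semigroup s (Kernel.measurable_coe _ hB)
  have hclose (v : ℝ) : dist (G.jumpState u v) (G.jumpState u' v) ≤ ρ :=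
    (G.dist_jumpState_le u u' v).trans ((le_div_iff₀' G.keep_pos).1 hdist)
  have hmeas : Measurable fun v => semigroup G.rateKernel t (G.jumpState u v) A :=
    (Kernel.measurable_coe _ hA).comp (G.measurable_jumpState_right u)
  calc w * (ε * volume K) = w * ∫⁻ _ in K, ε := by rw [setLIntegral_const]
    _ ≤ w * ∫⁻ v in K, (semigroup G.rateKernel t (G.jumpState u v) A +
          semigroup G.rateKernel t (G.jumpState u' v) Aᶜ) := by
        gcongr with v
        exact h _ _ (hclose v) A hA
    _ = w * (∫⁻ v in K, semigroup G.rateKernel t (G.jumpState u v) A) +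
          w * ∫⁻ v in K, semigroup G.rateKernel t (G.jumpState u' v) Aᶜ := by
        rw [lintegral_add_left hmeas, mul_add]
    _ ≤ _ := add_le_add (hmass u hA) (hmass u' hA.compl)

variable (G) in
/- One collision contracts distances by the factor `keep`, so waiting for `n` more collisions turns
an overlap of the laws from states at distance `ρ` into one from states at distance
`ρ / keep ^ n`. -/
theorem exists_dobrushinLE_semigroup :
    ∃ t > 0, ∃ q < 1, DobrushinLE (semigroup G.rateKernel t) q := by
  obtain ⟨K, c, hK⟩ := G.exists_isCore
  obtain ⟨ρ, hρ, hbase⟩ := hK.exists_overlapping_semigroup_one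
  have hoverlap (n : ℕ) :
      ∃ ε ≠ 0, Overlapping (semigroup G.rateKernel (n + 1)) (ρ / G.keep ^ n) ε := by
    induction n with
    | zero => simpa using hbase
    | succ n ih =>
      obtain ⟨ε, hε, h⟩ := ih
      refine ⟨_, mul_ne_zero hK.exp_mul_ne_zero (mul_ne_zero hε hK.volume_pos.ne'), ?_⟩
      rw [pow_succ, ← div_div, Nat.cast_succ, add_comm]
      exact hK.overlapping_semigroup_one_add (by positivity) h
  obtain ⟨n, hn⟩ : ∃ n : ℕ, G.Vbar - -G.Vbar ≤ ρ / G.keep ^ n := by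
    obtain ⟨n, hn⟩ := exists_pow_lt_of_lt_one (div_pos hρ (sub_pos.2 (neg_lt_self G.Vbar_pos)))
      G.keep_lt_one
    exact ⟨n, ((lt_div_comm₀ (pow_pos G.keep_pos n) (sub_pos.2 (neg_lt_self G.Vbar_pos))).1 hn).le⟩
  obtain ⟨ε, hε, h⟩ := hoverlap n
  have : Nonempty G.states := ⟨0, neg_nonpos.2 G.Vbar_pos.le, G.Vbar_pos.le⟩
  exact ⟨n + 1, by positivity,
    h.exists_dobrushinLE (fun u u' => (Real.dist_le_of_mem_Icc u.2 u'.2).trans hn) hε⟩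

end PistonModel

end

section

open JumpProcess

namespace PistonModel

variable (G : PistonModel)

theorem volume_preimage_collide (u : ℝ) (A : Set ℝ) :
    volume (G.collide u ⁻¹' A) = ENNReal.ofReal G.kick⁻¹ * volume A := by
  have hpre : G.collide u ⁻¹' A = (G.kick * ·) ⁻¹' ((G.keep * u + ·) ⁻¹' A) := rfl
  rw [hpre, Real.volume_preimage_mul_left G.kick_pos.ne', measure_preimage_add,
    abs_of_pos (inv_pos.2 G.kick_pos)]

theorem volume_preimage_reflect_eq_zero {A : Set ℝ} (hA : volume A = 0) :
    volume (G.reflect ⁻¹' A) = 0 := by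
  have hmirror (x : ℝ) : volume ((x - ·) ⁻¹' A) = 0 :=
    (quasiMeasurePreserving_sub_left_of_right_invariant volume x).preimage_null hA
  refine measure_mono_null (fun w hw => ?_)
    (measure_union_null hA (measure_union_null (hmirror (2 * G.Vbar)) (hmirror (-2 * G.Vbar))))
  rw [mem_preimage, reflect] at hw
  split_ifs at hw
  · exact .inr (.inl hw)
  · exact .inr (.inr hw)
  · exact .inl hw

theorem volume_preimage_jump_eq_zero (u : ℝ) {A : Set ℝ} (hA : volume A = 0) :
    volume (G.jump u ⁻¹' A) = 0 := by
  have hpre : G.jump u ⁻¹' A = G.collide u ⁻¹' (G.reflect ⁻¹' A) := rfl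
  rw [hpre, volume_preimage_collide, G.volume_preimage_reflect_eq_zero hA, mul_zero]

variable {G}

theorem SingleReflection.rateKernel_apply_eq_zero (h : G.SingleReflection) (u : G.states)
    {A : Set ℝ} (hA : MeasurableSet A) (hA₀ : volume A = 0) :
    G.rateKernel u ((↑) ⁻¹' A) = 0 := by
  have hpre : MeasurableSet ((↑) ⁻¹' A : Set G.states) := measurable_subtype_coe hA
  rw [← lintegral_indicator_one hpre, G.lintegral_rateKernel u (measurable_one.indicator hpre)]
  refine lintegral_eq_zero_of_ae_eq_zero ?_
  filter_upwards [measure_eq_zero_iff_ae_notMem.1 (G.volume_preimage_jump_eq_zero u hA₀)] with v hv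
  rcases le_or_gt G.vmax |v| with hfast | hslow
  · rw [G.rate_eq_zero hfast, zero_mul, Pi.zero_apply]
  · rw [indicator_of_notMem, mul_zero, Pi.zero_apply]
    rwa [mem_preimage, h.coe_jumpState u hslow.le]

theorem SingleReflection.trans_eq_of_volume_eq_zero (h : G.SingleReflection) {t u : ℝ} (ht : 0 ≤ t)
    (hu : u ∈ G.states) {A : Set ℝ} (hA : MeasurableSet A) (hA₀ : volume A = 0) :
    G.trans t u A = G.transN 0 t u A := by
  lift u to G.states using hu
  rw [h.trans_eq ht u hA, h.transN_eq 0 ht u hA, semigroup, ProbabilityTheory.Kernel.comap_apply,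
    law_apply_of_rate_eq_zero (measurable_subtype_coe hA)
      (fun w => h.rateKernel_apply_eq_zero w hA hA₀), jumpLaw_zero]

variable (G) in
theorem totalRate_pos {u : ℝ} (hu : u ∈ G.states) : 0 < G.totalRate u := by
  obtain ⟨K, c, hK⟩ := G.exists_isCore
  refine ENNReal.toReal_pos (pos_iff_ne_zero.1 ?_)
    (ne_top_of_le_ne_top ENNReal.ofReal_ne_top (G.lintegral_rate_le hu))
  calc 0 < c * volume K := ENNReal.mul_pos hK.ne_zero hK.volume_pos.ne'
    _ = ∫⁻ _ in K, c := (setLIntegral_const K c).symm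
    _ ≤ ∫⁻ v in K, G.rate u v := setLIntegral_mono' hK.measurableSet (hK.le_rate u hu)
    _ ≤ ∫⁻ v, G.rate u v := setLIntegral_le_lintegral K _

theorem IsStationary.absolutelyContinuous {μ : Measure ℝ} (hμ : G.IsStationary μ)
    (h : G.SingleReflection) : μ ≪ volume := by
  have := hμ.1.1
  refine Measure.AbsolutelyContinuous.mk fun A hA hA₀ => ?_
  by_contra hne
  have hsurvival (u : ℝ) (hu : u ∈ G.states) :
      ENNReal.ofReal (Real.exp (-G.totalRate u * 1)) < 1 := by
    simp [G.totalRate_pos hu]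
  have hdecrease : G.evolve μ 1 A < μ A := by
    calc G.evolve μ 1 A
        = ∫⁻ u, A.indicator (fun u => ENNReal.ofReal (Real.exp (-G.totalRate u * 1))) u ∂μ := by
          refine lintegral_congr_ae ?_
          filter_upwards [hμ.1.ae_mem] with u hu
          rw [h.trans_eq_of_volume_eq_zero zero_le_one hu hA hA₀, transN]
          by_cases hmem : u ∈ A <;> simp [hmem]
      _ = ∫⁻ u in A, ENNReal.ofReal (Real.exp (-G.totalRate u * 1)) ∂μ := lintegral_indicator hA _
      _ < ∫⁻ _ in A, 1 ∂μ := by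
          refine setLIntegral_strict_mono hA hne measurable_one ?_
            (hμ.1.ae_mem.mono fun u hu _ => hsurvival u hu)
          refine ne_top_of_le_ne_top (measure_ne_top μ A) ?_
          rw [← setLIntegral_one]
          exact lintegral_mono_ae
            (ae_restrict_of_ae (hμ.1.ae_mem.mono fun u hu => (hsurvival u hu).le))
      _ = μ A := setLIntegral_one A
  exact hdecrease.ne (hμ.2 1 zero_le_one A hA)

theorem IsStationary.absolutelyContinuous_restrict_Ioo {μ : Measure ℝ} (hμ : G.IsStationary μ)
    (h : G.SingleReflection) : μ ≪ volume.restrict (Ioo (-G.Vbar) G.Vbar) := by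
  rw [restrict_Ioo_eq_restrict_Icc, ← Measure.restrict_eq_self_of_ae_mem hμ.1.ae_mem]
  exact (hμ.absolutelyContinuous h).restrict _

end PistonModel

end

section

open Pointwise

theorem ae_measure_prodMk_right_preimage_eq_zero {α β : Type*} [MeasurableSpace α]
    [MeasurableSpace β] {μ : Measure α} {ν : Measure β} [SFinite μ] [SFinite ν] {s : Set (α × β)}
    (hs : μ.prod ν s = 0) : ∀ᵐ y ∂ν, μ ((·, y) ⁻¹' s) = 0 :=
  Measure.measure_ae_null_of_prod_null
    (Measure.measurePreserving_swap.quasiMeasurePreserving.preimage_null hs)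

namespace PistonModel

variable (G : PistonModel)

/-- The pairs of velocities before and after an elastic collision with an atom whose velocity lies
in `K`. -/
def collisions (K : Set ℝ) : Set (ℝ × ℝ) := {p | (p.2 - G.keep * p.1) / G.kick ∈ K}

theorem measurableSet_collisions {K : Set ℝ} (hK : MeasurableSet K) :
    MeasurableSet (G.collisions K) := by
  have hatom : Measurable fun p : ℝ × ℝ => (p.2 - G.keep * p.1) / G.kick := by fun_prop
  exact hatom hK

theorem prodMk_preimage_collisions (K : Set ℝ) (u : ℝ) :
    Prod.mk u ⁻¹' G.collisions K = G.keep * u +ᵥ G.kick • K := by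
  ext w
  rw [mem_vadd_set_iff_neg_vadd_mem, mem_smul_set_iff_inv_smul_mem₀ G.kick_pos.ne']
  simp only [collisions, mem_preimage, mem_ofPred_eq, smul_eq_mul, vadd_eq_add, div_eq_inv_mul,
    neg_add_eq_sub]

theorem prodMk_right_preimage_collisions (K : Set ℝ) (w : ℝ) :
    (·, w) ⁻¹' G.collisions K = w / G.keep +ᵥ (-(G.kick / G.keep)) • K := by
  have hkeep := G.keep_pos.ne'
  have hkick := G.kick_pos.ne'
  ext u
  rw [mem_vadd_set_iff_neg_vadd_mem,
    mem_smul_set_iff_inv_smul_mem₀ (neg_ne_zero.2 (div_ne_zero hkick hkeep))]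
  have hatom : (-(G.kick / G.keep))⁻¹ • (-(w / G.keep) +ᵥ u) = (w - G.keep * u) / G.kick := by
    rw [smul_eq_mul, vadd_eq_add]
    field_simp
    ring
  rw [hatom]
  rfl

theorem volume_prodMk_right_preimage_collisions_pos {K : Set ℝ} (hK : 0 < volume K) (w : ℝ) :
    0 < volume ((·, w) ⁻¹' G.collisions K) := by
  rw [prodMk_right_preimage_collisions, measure_vadd, Measure.addHaar_smul]
  refine ENNReal.mul_pos ?_ hK.ne'
  simp [G.keep_pos.ne', G.kick_pos.ne']

theorem volume_inter_preimage_collide (K A : Set ℝ) (u : ℝ) :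
    volume (K ∩ G.collide u ⁻¹' A) =
      ENNReal.ofReal G.kick⁻¹ * volume (A ∩ Prod.mk u ⁻¹' G.collisions K) := by
  rw [← volume_preimage_collide _ u]
  congr 1
  ext v
  have hatom : (G.collide u v - G.keep * u) / G.kick = v := by
    rw [collide_eq, add_sub_cancel_left, mul_div_cancel_left₀ _ G.kick_pos.ne']
  simp only [mem_inter_iff, mem_preimage, collisions, mem_ofPred_eq, hatom, and_comm]

variable {G}

theorem lowerSemicontinuous_measure_prodMk_preimage_collisions {μ : Measure ℝ} [IsFiniteMeasure μ]
    (hμ : μ ≪ volume) {K : Set ℝ} (hK : IsCompact K) :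
    LowerSemicontinuous fun u => μ (Prod.mk u ⁻¹' G.collisions K) := by
  simp only [prodMk_preimage_collisions]
  have hK' := hK.smul G.kick
  exact (lowerSemicontinuous_measure_vadd hμ hK' hK'.isClosed).comp
    (continuous_const.mul continuous_id)

theorem lowerSemicontinuous_measure_prodMk_right_preimage_collisions {μ : Measure ℝ}
    [IsFiniteMeasure μ] (hμ : μ ≪ volume) {K : Set ℝ} (hK : IsCompact K) :
    LowerSemicontinuous fun w => μ ((·, w) ⁻¹' G.collisions K) := by
  simp only [prodMk_right_preimage_collisions]
  have hK' := hK.smul (-(G.kick / G.keep))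
  exact (lowerSemicontinuous_measure_vadd hμ hK' hK'.isClosed).comp
    (continuous_id.div_const G.keep)

variable {K : Set ℝ} {c : ℝ≥0∞}

theorem IsCore.le_trans_one (hK : G.IsCore K c) (h : G.SingleReflection) {u : ℝ}
    (hu : u ∈ G.states) {A : Set ℝ} (hA : MeasurableSet A) :
    ENNReal.ofReal (Real.exp (-G.maxRate)) * c * volume (K ∩ G.jump u ⁻¹' A) ≤ G.trans 1 u A := by
  lift u to G.states using hu
  rw [h.trans_eq zero_le_one u hA]
  refine le_trans (mul_le_mul_right (measure_mono fun v hv => ?_) _)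
    (hK.le_semigroup_one_apply u (measurable_subtype_coe hA))
  refine ⟨hv.1, ?_⟩
  rw [mem_preimage, mem_preimage, h.coe_jumpState u (hK.abs_mem v hv.1).2.le]
  exact hv.2

theorem IsStationary.mul_prod_preimage_jump_le {μ : Measure ℝ} (hμ : G.IsStationary μ)
    (h : G.SingleReflection) (hK : G.IsCore K c) {A : Set ℝ} (hA : MeasurableSet A) :
    ENNReal.ofReal (Real.exp (-G.maxRate)) * c *
      μ.prod (volume.restrict K) ((fun p => G.jump p.1 p.2) ⁻¹' A) ≤ μ A := by
  have hpre := G.measurable_jump hA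
  rw [Measure.prod_apply hpre, ← lintegral_const_mul _ (measurable_measure_prodMk_left hpre),
    ← hμ.2 1 zero_le_one A hA]
  refine lintegral_mono_ae ?_
  filter_upwards [hμ.1.ae_mem] with u hu
  rw [Measure.restrict_apply (measurable_prodMk_left hpre), inter_comm]
  exact hK.le_trans_one h hu hA

theorem IsStationary.mul_prod_collisions_le {μ : Measure ℝ} (hμ : G.IsStationary μ)
    (h : G.SingleReflection) (hK : G.IsCore K c) {A : Set ℝ} (hA : MeasurableSet A)
    (hAs : A ⊆ G.states) :
    ENNReal.ofReal (Real.exp (-G.maxRate)) * c * (ENNReal.ofReal G.kick⁻¹ *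
      μ.prod (volume.restrict A) (G.collisions K)) ≤ μ A := by
  have := hμ.1.1
  have hcoll := G.measurableSet_collisions hK.measurableSet
  have hpre := G.measurable_jump hA
  refine le_trans (mul_le_mul_right ?_ _) (hμ.mul_prod_preimage_jump_le h hK hA)
  rw [Measure.prod_apply hcoll, Measure.prod_apply hpre,
    ← lintegral_const_mul _ (measurable_measure_prodMk_left hcoll)]
  refine lintegral_mono fun u => ?_
  rw [Measure.restrict_apply (measurable_prodMk_left hcoll), inter_comm,
    ← volume_inter_preimage_collide, Measure.restrict_apply (measurable_prodMk_left hpre),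
    inter_comm _ K]
  refine measure_mono (inter_subset_inter_right K fun v hv => ?_)
  rwa [mem_preimage, mem_preimage, jump, G.reflect_of_mem (hAs hv)]

theorem IsStationary.exists_mapsTo_support {μ : Measure ℝ} (hμ : G.IsStationary μ)
    (h : G.SingleReflection) (hK : G.IsCore K c) {B : Set ℝ} (hB : volume (K ∩ B) ≠ 0) :
    ∃ v ∈ K ∩ B, MapsTo (G.jump · v) μ.support μ.support := by
  have := hμ.1.1
  have hopen : IsOpen μ.supportᶜ := Measure.isOpen_compl_support
  have hnull := hμ.mul_prod_preimage_jump_le h hK hopen.measurableSet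
  rw [Measure.measure_compl_support, nonpos_iff_eq_zero, mul_eq_zero,
    or_iff_right hK.exp_mul_ne_zero] at hnull
  have hae := ae_measure_prodMk_right_preimage_eq_zero hnull
  rw [ae_restrict_iff' hK.measurableSet] at hae
  obtain ⟨v, hv, hv₀⟩ := ((frequently_ae_mem_iff.2 hB).and_eventually hae).exists
  refine ⟨v, hv, fun u hu => ?_⟩
  have hcont : Continuous (G.jump · v) :=
    G.continuous_jump.comp (continuous_id.prodMk continuous_const)
  by_contra hout
  exact Measure.subset_compl_support_of_isOpen (hopen.preimage hcont) (hv₀ hv.1) hout hu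

theorem mem_states_of_collide_mem (hheavy : G.kick * G.vmax ≤ G.keep * G.Vbar) {u v : ℝ}
    (hv : |v| ∈ Ioo G.vmin G.vmax) (hw : G.collide u v ∈ G.states)
    (hsign : 0 ≤ v * G.collide u v) : u ∈ G.states := by
  have hsum : G.keep * G.Vbar + G.kick * G.Vbar = G.Vbar := by
    rw [← add_mul, keep_add_kick, one_mul]
  have hlow : G.kick * G.Vbar < G.kick * |v| :=
    mul_lt_mul_of_pos_left (G.Vbar_lt_vmin.trans hv.1) G.kick_pos
  have hhigh : G.kick * |v| < G.kick * G.vmax := mul_lt_mul_of_pos_left hv.2 G.kick_pos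
  suffices |G.keep * u| ≤ G.keep * G.Vbar by
    rw [abs_mul, abs_of_pos G.keep_pos] at this
    exact abs_le.1 (le_of_mul_le_mul_left this G.keep_pos)
  rw [collide_eq] at hw hsign
  obtain ⟨hw₁, hw₂⟩ := hw
  rw [abs_le]
  rcases mul_nonneg_iff.1 hsign with ⟨hv₀, hw₀⟩ | ⟨hv₀, hw₀⟩
  · rw [abs_of_nonneg hv₀] at hlow hhigh
    constructor <;> linarith
  · rw [abs_of_nonpos hv₀] at hlow hhigh
    constructor <;> linarith

theorem mem_image_jump_states (hheavy : G.kick * G.vmax ≤ G.keep * G.Vbar) {v w : ℝ}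
    (hv : |v| ∈ Ioo G.vmin G.vmax) (hw : w ∈ G.states) (hsign : 0 ≤ v * w) :
    w ∈ (G.jump · v) '' G.states := by
  have hcollide : G.collide ((w - G.kick * v) / G.keep) v = w := by
    rw [collide_eq, mul_div_cancel₀ _ G.keep_pos.ne', sub_add_cancel]
  refine ⟨(w - G.kick * v) / G.keep, ?_, ?_⟩
  · refine mem_states_of_collide_mem hheavy hv ?_ ?_ <;> rwa [hcollide]
  · simp only [jump, hcollide, G.reflect_of_mem hw]

/- Collisions with atoms of a fixed velocity contract the state space, and two opposite atom
velocities suffice to reach every state. -/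
theorem IsStationary.states_subset_support {μ : Measure ℝ} (hμ : G.IsStationary μ)
    (h : G.SingleReflection) (hheavy : G.kick * G.vmax ≤ G.keep * G.Vbar) :
    G.states ⊆ μ.support := by
  have := hμ.1.1
  obtain ⟨K, c, hK⟩ := G.exists_isCore
  obtain ⟨v, ⟨hvK, hv₀⟩, hv⟩ := hμ.exists_mapsTo_support h hK hK.volume_Ioi_pos.ne'
  obtain ⟨v', ⟨hvK', hv₀'⟩, hv'⟩ := hμ.exists_mapsTo_support h hK hK.volume_Iio_pos.ne'
  refine subset_of_subset_iUnion_image_of_contracting (K := ⟨G.keep, G.keep_pos.le⟩)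
    (T := fun (x : {x // x ∈ K ∧ MapsTo (G.jump · x) μ.support μ.support}) u => G.jump u x)
    G.keep_lt_one (fun x => LipschitzWith.of_dist_le_mul fun u u' => G.dist_jump_le u u' x)
    (Metric.isBounded_Icc _ _) ?_ Measure.isClosed_support ?_ fun x => x.2.2
  · intro w hw
    rw [mem_iUnion]
    rcases le_total 0 w with hw₀ | hw₀
    · exact ⟨⟨v, hvK, hv⟩, mem_image_jump_states hheavy (hK.abs_mem v hvK) hw
        (mul_nonneg (le_of_lt hv₀) hw₀)⟩
    · exact ⟨⟨v', hvK', hv'⟩, mem_image_jump_states hheavy (hK.abs_mem v' hvK') hw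
        (mul_nonneg_of_nonpos_of_nonpos (le_of_lt hv₀') hw₀)⟩
  · exact Measure.nonempty_support (IsProbabilityMeasure.ne_zero μ)

theorem IsCore.volume_states_inter_collisions_pos (hK : G.IsCore K c)
    (hheavy : G.kick * G.vmax ≤ G.keep * G.Vbar) {w : ℝ} (hw : w ∈ G.states) :
    0 < volume (G.states ∩ (·, w) ⁻¹' G.collisions K) := by
  have hsource {B : Set ℝ} (hB : 0 < volume (K ∩ B)) (hsign : ∀ v ∈ B, 0 ≤ v * w) :
      0 < volume (G.states ∩ (·, w) ⁻¹' G.collisions K) := by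
    refine (G.volume_prodMk_right_preimage_collisions_pos hB w).trans_le
      (measure_mono fun u hu => ⟨?_, hu.1⟩)
    have hcollide : G.collide u ((w - G.keep * u) / G.kick) = w := by
      rw [collide_eq, mul_div_cancel₀ _ G.kick_pos.ne', add_sub_cancel]
    refine mem_states_of_collide_mem hheavy (hK.abs_mem _ hu.1) ?_ ?_ <;> rw [hcollide]
    exacts [hw, hsign _ hu.2]
  rcases le_total 0 w with hw₀ | hw₀
  · exact hsource hK.volume_Ioi_pos fun v hv => mul_nonneg (le_of_lt hv) hw₀
  · exact hsource hK.volume_Iio_pos fun v hv =>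
      mul_nonneg_of_nonpos_of_nonpos (le_of_lt hv) hw₀

/- The volume of the part of `A` reached by one collision is a lower semicontinuous function of the
initial velocity, so it vanishes everywhere if it vanishes `μ`-almost everywhere and `μ` has full
support; on the other hand, every point of `A` is reached from a set of positive volume. -/
theorem IsStationary.volume_eq_zero_of_measure_eq_zero {μ : Measure ℝ} (hμ : G.IsStationary μ)
    (h : G.SingleReflection) (hheavy : G.kick * G.vmax ≤ G.keep * G.Vbar) {A : Set ℝ}
    (hA : MeasurableSet A) (hAs : A ⊆ G.states) (hA₀ : μ A = 0) : volume A = 0 := by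
  have := hμ.1.1
  obtain ⟨K, c, hK⟩ := G.exists_isCore
  have hcoll := G.measurableSet_collisions hK.measurableSet
  have : IsFiniteMeasure (volume.restrict A) :=
    isFiniteMeasure_restrict.2 (ne_top_of_le_ne_top measure_Icc_lt_top.ne (measure_mono hAs))
  set target : ℝ → ℝ≥0∞ := fun u => volume.restrict A (Prod.mk u ⁻¹' G.collisions K)
  have hopen : IsOpen {u | 0 < target u} :=
    (lowerSemicontinuous_measure_prodMk_preimage_collisions
      Measure.restrict_le_self.absolutelyContinuous hK.isCompact).isOpen_preimage 0
  have hnull : μ {u | 0 < target u} = 0 := by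
    have hle := hμ.mul_prod_collisions_le h hK hA hAs
    rw [hA₀, nonpos_iff_eq_zero, mul_eq_zero, or_iff_right hK.exp_mul_ne_zero, mul_eq_zero,
      or_iff_right (by simp [G.kick_pos]), Measure.measure_prod_null hcoll] at hle
    exact measure_mono_null (fun u hu => ne_of_gt hu) (ae_iff.1 hle)
  have hzero (u : ℝ) (hu : u ∈ G.states) : target u = 0 := by
    by_contra hne
    exact Measure.subset_compl_support_of_isOpen hopen hnull (pos_iff_ne_zero.2 hne)
      (hμ.states_subset_support h hheavy hu)
  have hprod : (volume.restrict G.states).prod (volume.restrict A) (G.collisions K) = 0 := by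
    rw [Measure.measure_prod_null hcoll]
    exact ae_restrict_of_forall_mem G.measurableSet_states hzero
  have hae := ae_measure_prodMk_right_preimage_eq_zero hprod
  rw [ae_restrict_iff' hA, ae_iff] at hae
  refine measure_mono_null ?_ hae
  intro w hw hslice
  have hzero_slice := hslice hw
  rw [Measure.restrict_apply' G.measurableSet_states, inter_comm] at hzero_slice
  exact (hK.volume_states_inter_collisions_pos hheavy (hAs hw)).ne' hzero_slice

theorem IsStationary.exists_le_measure_prodMk_right_preimage_collisions {μ : Measure ℝ}
    (hμ : G.IsStationary μ) (h : G.SingleReflection)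
    (hheavy : G.kick * G.vmax ≤ G.keep * G.Vbar) (hK : G.IsCore K c) :
    ∃ k ≠ 0, ∀ w ∈ G.states, k ≤ μ ((·, w) ⁻¹' G.collisions K) := by
  have := hμ.1.1
  have hlsc := lowerSemicontinuous_measure_prodMk_right_preimage_collisions (G := G)
    (hμ.absolutelyContinuous h) hK.isCompact
  obtain ⟨w₀, hw₀, hmin⟩ := (hlsc.lowerSemicontinuousOn G.states).exists_isMinOn
    (nonempty_Icc.2 (neg_le_self G.Vbar_pos.le)) isCompact_Icc
  refine ⟨_, fun hzero => ?_, fun w hw => hmin hw⟩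
  exact (hK.volume_states_inter_collisions_pos hheavy hw₀).ne' <|
    hμ.volume_eq_zero_of_measure_eq_zero h hheavy (G.measurableSet_states.inter
      (measurable_prodMk_right (G.measurableSet_collisions hK.measurableSet)))
      inter_subset_left (measure_mono_null inter_subset_right hzero)

theorem IsStationary.exists_smul_volume_le {μ : Measure ℝ} (hμ : G.IsStationary μ)
    (h : G.SingleReflection) (hheavy : G.kick * G.vmax ≤ G.keep * G.Vbar) :
    ∃ k : ℝ, 0 < k ∧ ENNReal.ofReal k • volume.restrict (Ioo (-G.Vbar) G.Vbar) ≤ μ := by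
  have := hμ.1.1
  obtain ⟨K, c, hK⟩ := G.exists_isCore
  obtain ⟨a, ha, hle⟩ := hμ.exists_le_measure_prodMk_right_preimage_collisions h hheavy hK
  have hw := hK.exp_mul_ne_zero
  set w := ENNReal.ofReal (Real.exp (-G.maxRate)) * c
  obtain ⟨k, hk, hka⟩ : ∃ k : NNReal, 0 < k ∧ k < w * (ENNReal.ofReal G.kick⁻¹ * a) := by
    simpa only [ENNReal.coe_pos] using ENNReal.lt_iff_exists_nnreal_btwn.1 <|
      ENNReal.mul_pos hw (mul_ne_zero (by simp [G.kick_pos]) ha)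
  refine ⟨k, hk, Measure.le_iff.2 fun A hA => ?_⟩
  have hB : MeasurableSet (A ∩ Ioo (-G.Vbar) G.Vbar) := hA.inter measurableSet_Ioo
  have hBs : A ∩ Ioo (-G.Vbar) G.Vbar ⊆ G.states := inter_subset_right.trans Ioo_subset_Icc_self
  rw [ENNReal.ofReal_coe_nnreal, Measure.smul_apply, smul_eq_mul, Measure.restrict_apply hA]
  set B := A ∩ Ioo (-G.Vbar) G.Vbar
  calc k * volume B ≤ w * (ENNReal.ofReal G.kick⁻¹ * a) * volume B := by gcongr
    _ = w * (ENNReal.ofReal G.kick⁻¹ * ∫⁻ _ in B, a) := by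
        rw [setLIntegral_const]
        ring
    _ ≤ w * (ENNReal.ofReal G.kick⁻¹ * ∫⁻ y in B, μ ((·, y) ⁻¹' G.collisions K)) := by
        gcongr 2
        exact setLIntegral_mono' hB fun y hy => hle y (hBs hy)
    _ = w * (ENNReal.ofReal G.kick⁻¹ * μ.prod (volume.restrict B) (G.collisions K)) := by
        rw [Measure.prod_apply_symm (G.measurableSet_collisions hK.measurableSet)]
    _ ≤ μ B := hμ.mul_prod_collisions_le h hK hB hBs
    _ ≤ μ A := measure_mono inter_subset_left

end PistonModel

end

section

open ProbabilityTheory JumpProcess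

namespace PistonModel

variable {G : PistonModel}

theorem kick_mul_vmax_le (hheavy : 2 * G.m * G.vmax ≤ (G.M - G.m) * G.Vbar) :
    G.kick * G.vmax ≤ G.keep * G.Vbar := by
  rw [kick, keep, div_mul_eq_mul_div, div_mul_eq_mul_div]
  exact div_le_div_of_nonneg_right hheavy (by linarith [G.m_pos, G.m_lt_M])

theorem IsStationary.exists_density {μ : Measure ℝ} (hμ : G.IsStationary μ)
    (h : G.SingleReflection) :
    ∃ f : ℝ → ℝ≥0∞, Measurable f ∧
      μ = (volume.restrict (Ioo (-G.Vbar) G.Vbar)).withDensity f ∧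
      (2 * G.m * G.vmax ≤ (G.M - G.m) * G.Vbar →
        ∃ c : ℝ, 0 < c ∧ ∀ w ∈ Ioo (-G.Vbar) G.Vbar, ENNReal.ofReal c ≤ f w) := by
  have := hμ.1.1
  have hac := hμ.absolutelyContinuous_restrict_Ioo h
  by_cases hheavy : 2 * G.m * G.vmax ≤ (G.M - G.m) * G.Vbar
  · obtain ⟨c, hc, hle⟩ := hμ.exists_smul_volume_le h (kick_mul_vmax_le hheavy)
    obtain ⟨f, hf, hμf, hcf⟩ := exists_density_ge hac ENNReal.ofReal_ne_top hle
    exact ⟨f, hf, hμf, fun _ => ⟨c, hc, fun w _ => hcf w⟩⟩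
  · exact ⟨_, Measure.measurable_rnDeriv _ _, (Measure.withDensity_rnDeriv_eq _ _ hac).symm,
      fun hheavy' => absurd hheavy' hheavy⟩

theorem SingleReflection.evolve_univ (h : G.SingleReflection) {ν : Measure ℝ}
    (hν : G.IsDistribution ν) {t : ℝ} (ht : 0 ≤ t) : G.evolve ν t univ = 1 := by
  have := hν.isProbabilityMeasure_comap
  rw [h.evolve_eq hν ht MeasurableSet.univ, preimage_univ, measure_univ]

theorem SingleReflection.exists_isStationary (h : G.SingleReflection) :
    ∃ μ₀ : Measure ℝ, G.IsStationary μ₀ ∧ (∀ μ, G.IsStationary μ → μ = μ₀) ∧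
      ∃ C γ : ℝ, 0 < C ∧ 0 < γ ∧ ∀ ν, G.IsDistribution ν → ∀ t, 0 ≤ t →
        ∀ A, MeasurableSet A →
          |(G.evolve ν t A).toReal - (μ₀ A).toReal| ≤ C * Real.exp (-γ * t) := by
  obtain ⟨t₀, ht₀, q, hq, hcontr⟩ := exists_dobrushinLE_semigroup G
  have : Nonempty G.states := ⟨0, by simp [states, G.Vbar_pos.le]⟩
  obtain ⟨π, _, hinv, huniq, C, γ, hC, hγ, hconv⟩ :=
    hcontr.exists_invariant ht₀ hq fun s t hs ht => semigroup_add hs ht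
  refine ⟨π.map (↑), h.isStationary_iff.2 ⟨isDistribution_map π, ?_⟩, fun μ hμ => ?_,
    C, γ, hC, hγ, fun ν hν t ht A hA => ?_⟩
  · rwa [comap_map]
  · obtain ⟨hdist, hμinv⟩ := h.isStationary_iff.1 hμ
    rw [← hdist.map_comap, huniq _ hdist.isProbabilityMeasure_comap hμinv]
  · rw [h.evolve_eq hν ht hA, Measure.map_apply measurable_subtype_coe hA]
    exact hconv _ hν.isProbabilityMeasure_comap t ht _ (measurable_subtype_coe hA)

theorem SingleReflection.aemeasurable_trans (h : G.SingleReflection) {ν : Measure ℝ}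
    (hν : G.IsDistribution ν) {t : ℝ} (ht : 0 ≤ t) {A : Set ℝ} (hA : MeasurableSet A) :
    AEMeasurable (fun u => G.trans t u A) ν := by
  rw [← hν.map_comap,
    (MeasurableEmbedding.subtype_coe G.measurableSet_states).aemeasurable_map_iff]
  refine ((semigroup G.rateKernel t).measurable_coe
    (measurable_subtype_coe hA)).aemeasurable.congr (.of_forall fun u => ?_)
  exact (h.trans_eq ht u hA).symm

theorem IsPistonVelocity.isDistribution {Ω : Type*} [MeasurableSpace Ω] {P : Measure Ω}
    [IsProbabilityMeasure P] {W : ℝ → Ω → ℝ} (hW : G.IsPistonVelocity P W) :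
    G.IsDistribution (P.map (W 0)) := by
  have hW₀ := hW.measurable 0 le_rfl
  refine ⟨Measure.isProbabilityMeasure_map hW₀.aemeasurable, ?_⟩
  rw [Measure.map_apply hW₀ G.measurableSet_states.compl]
  exact hW.start

theorem IsPistonVelocity.measure_preimage {Ω : Type*} [MeasurableSpace Ω] {P : Measure Ω}
    [IsProbabilityMeasure P] {W : ℝ → Ω → ℝ} (hW : G.IsPistonVelocity P W)
    (h : G.SingleReflection) {t : ℝ} (ht : 0 ≤ t) {A : Set ℝ} (hA : MeasurableSet A) :
    P (W t ⁻¹' A) = G.evolve (P.map (W 0)) t A := by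
  have hmarkov := hW.markov 0 t le_rfl ht A hA univ MeasurableSet.univ
  rw [univ_inter, zero_add, Measure.restrict_univ] at hmarkov
  rw [hmarkov, evolve, lintegral_map' (h.aemeasurable_trans hW.isDistribution ht hA)
    (hW.measurable 0 le_rfl).aemeasurable]

end PistonModel

end

theorem mainTheorem3 (G : PistonModel)
    (hreflect : (G.M - G.m) / (G.M + G.m) * G.Vbar + 2 * G.m / (G.M + G.m) * G.vmax
      ≤ 3 * G.Vbar) :
    ∃ μ₀ : Measure ℝ,
      -- `μ₀` is the unique stationary measure
      G.IsStationary μ₀ ∧ (∀ μ : Measure ℝ, G.IsStationary μ → μ = μ₀) ∧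
      -- it is absolutely continuous, and its density is bounded below for a heavy piston
      (∃ f₀ : ℝ → ℝ≥0∞, Measurable f₀ ∧
        μ₀ = (volume.restrict (Ioo (-G.Vbar) G.Vbar)).withDensity f₀ ∧
        (2 * G.m * G.vmax ≤ (G.M - G.m) * G.Vbar →
          ∃ c : ℝ, 0 < c ∧ ∀ w ∈ Ioo (-G.Vbar) G.Vbar, ENNReal.ofReal c ≤ f₀ w)) ∧
      -- every initial distribution converges to it, uniformly and exponentially fast
      ∃ C γ : ℝ, 0 < C ∧ 0 < γ ∧
        (∀ ν : Measure ℝ, G.IsDistribution ν → ∀ t : ℝ, 0 ≤ t → G.evolve ν t univ = 1 ∧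
          ∀ A : Set ℝ, MeasurableSet A →
          |(G.evolve ν t A).toReal - (μ₀ A).toReal| ≤ C * Real.exp (-γ * t)) ∧
        (∀ (Ω : Type*) [MeasurableSpace Ω] (ℙ : Measure Ω) [IsProbabilityMeasure ℙ]
          (W : ℝ → Ω → ℝ), G.IsPistonVelocity ℙ W → ∀ t : ℝ, 0 ≤ t → ∀ A : Set ℝ,
          MeasurableSet A →
          |(ℙ (W t ⁻¹' A)).toReal - (μ₀ A).toReal| ≤ C * Real.exp (-γ * t)) := by
  have h : G.SingleReflection := hreflect
  obtain ⟨μ₀, hμ₀, hunique, C, γ, hC, hγ, hconv⟩ := h.exists_isStationary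
  refine ⟨μ₀, hμ₀, hunique, hμ₀.exists_density h, C, γ, hC, hγ,
    fun ν hν t ht => ⟨h.evolve_univ hν ht, hconv ν hν t ht⟩, fun Ω _ ℙ _ W hW t ht A hA => ?_⟩
  rw [hW.measure_preimage h ht hA]
  exact hconv _ hW.isDistribution t ht A hA
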